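/- All rings are commutative with unity and $n\ge 0$ is an integer. A $B$-algebra $A$ is locally free of rank $n$ if there are $b_1,\dots,b_m\in B$ with $\sum_i Bb_i=B$ such that $A\otimes_B B_{b_i}$ is free of rank $n$ over $B_{b_i}$ for all $i$; it is then called étale if the trace form is perfect, i.e. if $\Phi:A\to\mathrm{Hom}_B(A,B)$, $a\mapsto(a'\mapsto \mathrm{Tr}^A_B(aa'))$ is an isomorphism. For $A$ locally free of rank $n$ over $B$ and $a\in A$ let $s_j(a)$ be the trace of the endomorphism of $\bigwedge^j_B A$ induced by multiplication by $a$, let $a^{(i)}\in A^{\otimes n}$ be $1\otimes\cdots\otimes a\otimes\cdots\otimes1$ with $a$ in the $i$-th factor, and let $$G(A/B)=A^{\otimes n}\Big/\Big(s_j(a)-\sum_{1\le i_1<\cdots<i_j\le n}a^{(i_1)}\cdots a^{(i_j)}\ :\ a\in A,\ 1\le j\le n\Big),$$ on which $S_n$ acts by $B$-algebra automorphisms permuting the tensor factors, $\sigma\cdot a^{(i)}=a^{(\sigma(i))}$. **Theorem.** (1) Let $B$ be any ring and let $\epsilon_1,\dots,\epsilon_n$ be the standard basis of $B^n$. For $\sigma\in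 S_n$ let $e_\sigma\in G(B^n/B)$ be the image of $\prod_{i=1}^n \epsilon_i^{(\sigma(i))}$. Then $(e_\sigma)_{\sigma\in S_n}$ is a $B$-basis of $G(B^n/B)$ consisting of pairwise orthogonal idempotents with sum $1$, so that $G(B^n/B)\cong B^{n!}$ as $B$-algebras. Moreover $g\cdot e_\sigma=e_{g\sigma}$ for all $g,\sigma\in S_n$, and $e_\sigma\mapsto\sigma$ is an isomorphism $G(B^n/B)\cong B[S_n]$ of $B[S_n]$-modules. (2) If $A$ is étale and locally free of rank $n$ over $B$, then $G(A/B)$ is étale and locally free of rank $n!$ over $B$. (3) Let $f:X\to Y$ be an $n$-covering of schemes, i.e. $X=\underline{\mathrm{Spec}}_Y\mathcal A$ with $\mathcal A$ an $\mathcal O_Y$-algebra that is locally free of rank $n$ as an $\mathcal O_Y$-module, and let $G(X/Y)=\underline{\mathrm{Spec}}_Y\,G(\mathcal A/\mathcal O_Y)$, where $G(\mathcal A/\mathcal O_Y)$ is the quasi-coherent $\mathcal O_Y$-algebra whose sections over an affine open $U$ are $G(\mathcal A(U)/\mathcal O_Y(U))$. If $f$ is étale, then $G(X/Y)\to Y$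 is an $n!$-covering and is étale. -/

import Mathlib

open scoped TensorProduct

universe u v

noncomputable section

namespace SnClosure

section Trace

variable (B : Type*) [CommRing B] (M : Type*) [AddCommGroup M] [Module B M]

open Classical in
/-- The trace of endomorphisms of a module `M` for which the canonical map
`Hom(M, B) ⊗ M → End(M)` is bijective (for instance `M` finitely generated projective):
the composition `End(M) ≅ Hom(M, B) ⊗ M → B`. It is set to `0` if that map is not bijective. -/
def trace : (M →ₗ[B] M) →ₗ[B] B :=
  if h : Function.Bijective (dualTensorHom B M M) then
    contractLeft B M ∘ₗ (LinearEquiv.ofBijective (dualTensorHom B M M) h).symm.toLinearMap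
  else 0

end Trace

section Defs

variable (n : ℕ) (B : Type*) [CommRing B] (A : Type*) [CommRing A] [Algebra B A]

/-- `A` is locally free of rank `n` as a `B`-module: there are `b₁, …, bₘ ∈ B` with `∑ B bᵢ = B`
such that `B_{bᵢ} ⊗ A` is free of rank `n` over the localization `B_{bᵢ}` for all `i`. -/
def IsLocallyFree : Prop :=
  ∃ (m : ℕ) (b : Fin m → B), Ideal.span (Set.range b) = ⊤ ∧
    ∀ i, Nonempty (Module.Basis (Fin n) (Localization.Away (b i)) (Localization.Away (b i) ⊗[B] A))

/-- The map `Φ : A → Hom(A, B)`, `a ↦ (a' ↦ Tr(a a'))`, where `Tr(c)` is the trace of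
multiplication by `c`. -/
def traceMap : A →ₗ[B] Module.Dual B A :=
  (LinearMap.mul B A).compr₂ (trace B A ∘ₗ (Algebra.lmul B A).toLinearMap)

/-- A locally free algebra `A` of finite rank over `B` is étale if its trace form is perfect,
i.e. if `Φ : A → Hom(A, B)` is an isomorphism of `B`-modules (when `A` is free: if its discriminant
is a unit of `B`). -/
def IsEtale : Prop := Function.Bijective (traceMap B A)

variable {A}

/-- `s_j(a)`, the trace of the endomorphism of `⋀ʲ A` induced by multiplication by `a`: up to the
sign `(-1)ʲ`, the coefficient of `x^(n-j)` in the characteristic polynomial of `a` if `A` has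
rank `n`. -/
def s (j : ℕ) (a : A) : B :=
  trace B (⋀[B]^j A) (exteriorPower.map j (Algebra.lmul B A a))

/-- The relation
`s_j(a) - ∑_{i₁ < ⋯ < i_j} a^{(i₁)} ⋯ a^{(i_j)}` in the tensor power `A^{⊗ n}`, where
`a^{(i)} = 1 ⊗ ⋯ ⊗ a ⊗ ⋯ ⊗ 1` with `a` in the `i`-th factor. -/
def relation (j : ℕ) (a : A) : ⨂[B] _ : Fin n, A :=
  algebraMap B _ (s B j a) -
    ∑ t ∈ (Finset.univ : Finset (Fin n)).powersetCard j,
      ∏ i ∈ t, PiTensorProduct.singleAlgHom (R := B) (A := fun _ : Fin n => A) i a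

variable (A)

/-- The ideal `I(A, B)` of `A^{⊗ n}`. -/
def ideal : Ideal (⨂[B] _ : Fin n, A) :=
  Ideal.span {x | ∃ a : A, ∃ j ∈ Finset.Icc 1 n, x = relation n B j a}

end Defs

end SnClosure

/-- The `S_n`-closure `G(A/B) = A^{⊗ n} / I(A, B)` of a `B`-algebra `A` of rank `n`. -/
abbrev SnClosure (n : ℕ) (B : Type u) [CommRing B] (A : Type v) [CommRing A] [Algebra B A] :
    Type (max u v) :=
  (⨂[B] _ : Fin n, A) ⧸ SnClosure.ideal n B A

namespace SnClosure

section UniversalProperty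

variable (n : ℕ) (B : Type*) [CommRing B] (A : Type*) [CommRing A] [Algebra B A]

/-- The map `A → G(A/B)`, `a ↦ a^{(i)}`. -/
def conj (i : Fin n) : A →ₐ[B] SnClosure n B A :=
  (Ideal.Quotient.mkₐ B (ideal n B A)).comp
    (PiTensorProduct.singleAlgHom (R := B) (A := fun _ : Fin n => A) i)

variable {n B A}

lemma algebraMap_s {j : ℕ} (hj : j ∈ Finset.Icc 1 n) (a : A) :
    algebraMap B (SnClosure n B A) (s B j a) =
      ∑ t ∈ (Finset.univ : Finset (Fin n)).powersetCard j, ∏ i ∈ t, conj n B A i a := by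
  have h : Ideal.Quotient.mkₐ B (ideal n B A) (relation n B j a) = 0 := by
    rw [Ideal.Quotient.mkₐ_eq_mk, Ideal.Quotient.eq_zero_iff_mem]
    exact Ideal.subset_span ⟨a, j, hj, rfl⟩
  rw [relation, map_sub, sub_eq_zero, AlgHom.commutes] at h
  rw [h, map_sum]
  refine Finset.sum_congr rfl fun t _ => ?_
  rw [map_prod]
  rfl

/-- The algebra homomorphism out of the tensor power with given components. -/
def tensorLift {C : Type*} [CommRing C] [Algebra B C] (g : Fin n → (A →ₐ[B] C)) :
    (⨂[B] _ : Fin n, A) →ₐ[B] C :=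
  PiTensorProduct.liftAlgHom
    ((MultilinearMap.mkPiAlgebra B (Fin n) C).compLinearMap fun i => (g i).toLinearMap)
    (by simp [MultilinearMap.compLinearMap_apply])
    (fun x y => by simp [MultilinearMap.compLinearMap_apply, Finset.prod_mul_distrib])

lemma tensorLift_single {C : Type*} [CommRing C] [Algebra B C] (g : Fin n → (A →ₐ[B] C))
    (i : Fin n) (a : A) :
    tensorLift g (PiTensorProduct.singleAlgHom (R := B) (A := fun _ : Fin n => A) i a) = g i a := by
  refine (PiTensorProduct.lift.tprod _).trans ?_
  simp only [MultilinearMap.compLinearMap_apply, MultilinearMap.mkPiAlgebra_apply,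
    AlgHom.toLinearMap_apply, MonoidHom.mulSingle_apply]
  rw [Finset.prod_eq_single i]
  · simp
  · intro k _ hk
    simp [Pi.mulSingle_eq_of_ne hk]
  · simp

/-- The universal property of `G(A/B)`: algebra homomorphisms `g₁, …, g_n : A → C` such that
`s_j(a)` is the `j`-th elementary symmetric function of the `gᵢ(a)` induce `G(A/B) → C`. -/
def lift {C : Type*} [CommRing C] [Algebra B C] (g : Fin n → (A →ₐ[B] C))
    (hg : ∀ a, ∀ j ∈ Finset.Icc 1 n, algebraMap B C (s B j a) =
      ∑ t ∈ (Finset.univ : Finset (Fin n)).powersetCard j, ∏ i ∈ t, g i a) :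
    SnClosure n B A →ₐ[B] C :=
  Ideal.Quotient.liftₐ (ideal n B A) (tensorLift g) (by
    intro x hx
    suffices h : ideal n B A ≤ RingHom.ker (tensorLift g) from h hx
    refine Ideal.span_le.2 ?_
    rintro _ ⟨a, j, hj, rfl⟩
    simp only [SetLike.mem_coe, RingHom.mem_ker]
    rw [relation, map_sub, sub_eq_zero, AlgHom.commutes, hg a j hj, map_sum]
    refine Finset.sum_congr rfl fun t _ => ?_
    rw [map_prod]
    exact Finset.prod_congr rfl fun i _ => (tensorLift_single g i a).symm)

@[simp]
lemma lift_conj {C : Type*} [CommRing C] [Algebra B C] (g : Fin n → (A →ₐ[B] C)) (hg) (i : Fin n)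
    (a : A) : lift g hg (conj n B A i a) = g i a :=
  tensorLift_single g i a

lemma algHom_ext {C : Type*} [CommRing C] [Algebra B C] {f g : SnClosure n B A →ₐ[B] C}
    (h : ∀ i a, f (conj n B A i a) = g (conj n B A i a)) : f = g := by
  refine Ideal.Quotient.algHom_ext B ?_
  refine PiTensorProduct.algHom_ext fun i => ?_
  ext a
  exact h i a

lemma ringHom_ext {C : Type*} [CommRing C] {f g : SnClosure n B A →+* C}
    (h₀ : ∀ b, f (algebraMap B _ b) = g (algebraMap B _ b))
    (h : ∀ i a, f (conj n B A i a) = g (conj n B A i a)) : f = g := by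
  let _ : Algebra B C := (f.comp (algebraMap B (SnClosure n B A))).toAlgebra
  let f' : SnClosure n B A →ₐ[B] C := { f with commutes' := fun b => rfl }
  let g' : SnClosure n B A →ₐ[B] C := { g with commutes' := fun b => (h₀ b).symm }
  have : f' = g' := algHom_ext (f := f') (g := g') h
  exact RingHom.ext fun x => DFunLike.congr_fun this x

end UniversalProperty

section Action

variable (n : ℕ) (B : Type*) [CommRing B] (A : Type*) [CommRing A] [Algebra B A]

/-- The action of `S_n` on `G(A/B)` induced by the permutation of the tensor factors:
`σ` moves the `i`-th factor to the `σ(i)`-th place, i.e. `σ a^{(i)} = a^{(σ(i))}`. -/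
def action : Equiv.Perm (Fin n) →* (SnClosure n B A →ₐ[B] SnClosure n B A) where
  toFun σ := lift (fun i => conj n B A (σ i)) (by
    intro a j hj
    rw [algebraMap_s hj]
    refine (Finset.sum_equiv (Equiv.finsetCongr σ) ?_ ?_).symm
    · intro t
      simp [Finset.mem_powersetCard]
    · intro t _
      simp [Finset.prod_map])
  map_one' := algHom_ext fun i a => by simp
  map_mul' σ τ := algHom_ext fun i a => by simp

/-- On pure tensors, `σ (a₁ ⊗ ⋯ ⊗ a_n) = a_{σ⁻¹(1)} ⊗ ⋯ ⊗ a_{σ⁻¹(n)}`. -/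
lemma action_tprod (σ : Equiv.Perm (Fin n)) (a : Fin n → A) :
    action n B A σ (Ideal.Quotient.mk _ (PiTensorProduct.tprod B a)) =
      Ideal.Quotient.mk _ (PiTensorProduct.tprod B fun i => a (σ⁻¹ i)) := by
  have key : ∀ c : Fin n → A, (Ideal.Quotient.mk (ideal n B A) (PiTensorProduct.tprod B c) :
      SnClosure n B A) = ∏ i, conj n B A i (c i) := by
    intro c
    have : c = ∏ i, Pi.mulSingle i (c i) := by
      simpa using (Finset.univ_prod_mulSingle c).symm
    conv_lhs => rw [this, PiTensorProduct.tprod_prod, map_prod]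
    rfl
  rw [key, key, map_prod]
  simp only [action, MonoidHom.coe_mk, OneHom.coe_mk, lift_conj]
  exact Fintype.prod_equiv σ _ _ fun i => by simp

end Action

end SnClosure

namespace SnClosure

section BaseChange

lemma trace_eq_sum {B M : Type*} [CommRing B] [AddCommGroup M] [Module B M]
    (h : Function.Bijective (dualTensorHom B M M)) {κ : Type*} (t : Finset κ)
    (φ : κ → Module.Dual B M) (m : κ → M) (f : M →ₗ[B] M) (hf : ∀ x, f x = ∑ k ∈ t, φ k x • m k) :
    trace B M f = ∑ k ∈ t, φ k (m k) := by
  have hf' : f = LinearEquiv.ofBijective (dualTensorHom B M M) h (∑ k ∈ t, φ k ⊗ₜ m k) := by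
    ext x
    simp [hf, dualTensorHom_apply]
  rw [trace, dif_pos h, hf', LinearMap.comp_apply, LinearEquiv.coe_coe,
    LinearEquiv.symm_apply_apply]
  simp

variable {B : Type*} [CommRing B] {A : Type*} [CommRing A] [Algebra B A]

/-- A formula for `s_j(a)` in terms of a dual basis of `A`. -/
lemma s_eq_sum {r : ℕ} (φ : Fin r → Module.Dual B A) (m : Fin r → A)
    (h : ∀ x, ∑ k, φ k x • m k = x) (j : ℕ) (a : A) :
    s B j a = ∑ S : Set.powersetCard (Fin r) j,
      (Matrix.of fun i k => φ (Set.powersetCard.ofFinEmbEquiv.symm S k)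
        (a * m (Set.powersetCard.ofFinEmbEquiv.symm S i))).det := by
  let b := Pi.basisFun B (Fin r)
  let p : (Fin r → B) →ₗ[B] A := b.constr B m
  let i : A →ₗ[B] (Fin r → B) := LinearMap.pi φ
  have hp : ∀ k, p (b k) = m k := fun k => b.constr_basis B m k
  have hpi : p ∘ₗ i = LinearMap.id := by
    ext x
    simp only [LinearMap.comp_apply, LinearMap.id_apply]
    conv_rhs => rw [← h x]
    simp [p, i, b, Module.Basis.constr_apply_fintype]
  have hpi' : exteriorPower.map j p ∘ₗ exteriorPower.map j i = LinearMap.id := by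
    rw [← exteriorPower.map_comp, hpi, exteriorPower.map_id]
  have : Module.Projective B (⋀[B]^j A) := Module.Projective.of_split _ _ hpi'
  have : Module.Finite B (⋀[B]^j A) :=
    Module.Finite.of_surjective (exteriorPower.map j p) fun x =>
      ⟨exteriorPower.map j i x, DFunLike.congr_fun hpi' x⟩
  have hb : Function.Bijective (dualTensorHom B (⋀[B]^j A) (⋀[B]^j A)) :=
    (dualTensorHomEquiv B (⋀[B]^j A) (⋀[B]^j A)).bijective
  let c := b.exteriorPower j
  rw [s, trace_eq_sum hb Finset.univ
    (fun S => c.coord S ∘ₗ exteriorPower.map j i)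
    (fun S => exteriorPower.map j (Algebra.lmul B A a) (exteriorPower.map j p (c S)))]
  · refine Finset.sum_congr rfl fun S _ => ?_
    simp only [c, LinearMap.comp_apply, exteriorPower.coe_basis, exteriorPower.basis_coord,
      exteriorPower.map_apply_ιMulti_family]
    rw [exteriorPower.ιMulti_family, exteriorPower.ιMultiDual_apply_ιMulti]
    congr 1
    ext x y
    have hbi : ∀ k z, b.coord k (i z) = φ k z := fun k z => by
      simp [b, i, Module.Basis.coord_apply]
    simp only [Matrix.of_apply, Function.comp_apply, hbi, hp, Algebra.coe_lmul_eq_mul,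
      LinearMap.mul_apply']
  · intro x
    have hx : exteriorPower.map j p (exteriorPower.map j i x) = x := DFunLike.congr_fun hpi' x
    conv_lhs => rw [← hx, ← c.sum_repr (exteriorPower.map j i x)]
    simp only [map_sum, map_smul]
    rfl

lemma IsLocallyFree.finite_projective {n : ℕ} (h : IsLocallyFree n B A) :
    Module.Finite B A ∧ Module.Projective B A := by
  obtain ⟨m, b, hb, H⟩ := h
  have key : ∀ g : Set.range b,
      Module.Finite (Localization.Away g.1) (Localization.Away g.1 ⊗[B] A) ∧
      Module.Free (Localization.Away g.1) (Localization.Away g.1 ⊗[B] A) := by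
    rintro ⟨_, i, rfl⟩
    obtain ⟨c⟩ := H i
    exact ⟨Module.Finite.of_basis c, Module.Free.of_basis c⟩
  have h1 : Module.FinitePresentation B A := by
    refine Module.FinitePresentation.of_localizationSpan' (Set.range b) hb
      (Rₚ := fun g => Localization.Away g.1)
      (fun g => TensorProduct.mk B (Localization.Away g.1) A 1) fun g => ?_
    have := (key g).1
    have := (key g).2
    exact Module.finitePresentation_of_projective _ _
  have h2 : Module.Flat B A := by
    refine Module.flat_of_isLocalized_span (R := B) (S := B) (M := A) (Set.range b) hb
      (fun g => Localization.Away g.1 ⊗[B] A)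
      (fun g => TensorProduct.mk B (Localization.Away g.1) A 1) fun g => ?_
    have := (key g).2
    exact Module.Flat.trans B (Localization.Away g.1) _
  exact ⟨inferInstance, Module.Flat.projective_of_finitePresentation⟩

lemma exists_dual_basis [Module.Finite B A] [Module.Projective B A] :
    ∃ (r : ℕ) (φ : Fin r → Module.Dual B A) (m : Fin r → A), ∀ x, ∑ k, φ k x • m k = x := by
  obtain ⟨r, f, g, -, -, hfg⟩ := Module.Finite.exists_comp_eq_id_of_projective B A
  refine ⟨r, fun k => LinearMap.proj k ∘ₗ g, fun k => f (Pi.single k 1), fun x => ?_⟩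
  conv_rhs => rw [← LinearMap.id_apply (R := B) x, ← hfg, LinearMap.comp_apply,
    ← (Pi.basisFun B (Fin r)).sum_repr (g x)]
  simp

lemma algebraMap_s_localization (b : B) (B' A' : Type*) [CommRing B'] [CommRing A']
    [Algebra B B'] [Algebra A A'] [Algebra B A'] [Algebra B' A'] [IsScalarTower B A A']
    [IsScalarTower B B' A'] [IsLocalization.Away b B'] [IsLocalization.Away (algebraMap B A b) A']
    [Module.Finite B A] [Module.Projective B A] (j : ℕ) (a : A) :
    s B' j (algebraMap A A' a) = algebraMap B B' (s B j a) := by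
  have hA : IsLocalization (Algebra.algebraMapSubmonoid A (Submonoid.powers b)) A' := by
    rw [Algebra.algebraMapSubmonoid_powers]
    infer_instance
  let ι : A →ₗ[B] A' := (IsScalarTower.toAlgHom B A A').toLinearMap
  have : IsLocalizedModule (Submonoid.powers b) ι := isLocalizedModule_iff_isLocalization.2 hA
  have : IsLocalizedModule (Submonoid.powers b) (Algebra.linearMap B B') := inferInstance
  obtain ⟨r, φ, m, h⟩ := exists_dual_basis (B := B) (A := A)
  let φ' : Fin r → Module.Dual B' A' := fun k =>
    IsLocalizedModule.mapExtendScalars (Submonoid.powers b) ι (Algebra.linearMap B B') B' (φ k)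
  have hφ : ∀ k x, φ' k (algebraMap A A' x) = algebraMap B B' (φ k x) := fun k x =>
    IsLocalizedModule.map_apply (Submonoid.powers b) ι (Algebra.linearMap B B') (φ k) x
  have h' : ∀ x, ∑ k, φ' k x • algebraMap A A' (m k) = x := by
    intro x
    obtain ⟨⟨y, c⟩, hy⟩ := IsLocalizedModule.surj (Submonoid.powers b) ι x
    have hc : IsUnit (algebraMap B B' c) := IsLocalization.map_units B' c
    have hy' : algebraMap B B' c • x = algebraMap A A' y := by
      rw [algebraMap_smul]
      exact hy
    rw [← hc.smul_left_cancel, Finset.smul_sum]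
    simp_rw [← smul_assoc, ← map_smul (φ' _), hy', hφ]
    conv_rhs => rw [← h y, map_sum]
    simp_rw [Algebra.smul_def, map_mul, ← IsScalarTower.algebraMap_apply]
  rw [s_eq_sum φ m h, s_eq_sum φ' (fun k => algebraMap A A' (m k)) h', map_sum]
  refine Finset.sum_congr rfl fun S _ => ?_
  rw [RingHom.map_det]
  congr 1
  ext x y
  simp [← hφ]

end BaseChange

end SnClosure

namespace SnClosure

section Localization

lemma s_smul {B A : Type*} [CommRing B] [CommRing A] [Algebra B A] (j : ℕ) (c : B) (a : A) :
    s B j (c • a) = c ^ j * s B j a := by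
  have : exteriorPower.map j (Algebra.lmul B A (c • a)) =
      c ^ j • exteriorPower.map j (Algebra.lmul B A a) := by
    refine exteriorPower.linearMap_ext (AlternatingMap.ext fun v => ?_)
    simp only [LinearMap.compAlternatingMap_apply, exteriorPower.map_apply_ιMulti,
      LinearMap.smul_apply]
    have h := (exteriorPower.ιMulti B j (M := A)).toMultilinearMap.map_smul_univ (fun _ => c)
      (Algebra.lmul B A a ∘ v)
    simp only [Finset.prod_const, Finset.card_univ, Fintype.card_fin] at h
    refine Eq.trans ?_ h
    refine congrArg (exteriorPower.ιMulti B j (M := A)) ?_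
    ext i
    simp
  rw [s, this, map_smul, smul_eq_mul, s]

variable (n : ℕ) {B A B' A' : Type*} [CommRing B] [CommRing A] [Algebra B A]
  [CommRing B'] [CommRing A'] [Algebra B' A']

/-- The map `G(A/B) → G(A'/B')` induced by a commutative square of rings that is compatible with
the `s_j`. -/
def map (φ : B →+* B') (ψ : A →+* A') (hc : ∀ b, ψ (algebraMap B A b) = algebraMap B' A' (φ b))
    (hs : ∀ j a, s B' j (ψ a) = φ (s B j a)) : SnClosure n B A →+* SnClosure n B' A' :=
  letI : Algebra B (SnClosure n B' A') :=
    ((algebraMap B' (SnClosure n B' A')).comp φ).toAlgebra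
  (lift (n := n) (B := B) (A := A)
    (fun i =>
      { ((conj n B' A' i : A' →+* SnClosure n B' A').comp ψ) with
        commutes' := fun b => by
          change conj n B' A' i (ψ (algebraMap B A b)) = algebraMap B' _ (φ b)
          rw [hc, AlgHom.commutes] })
    (fun a j hj => by
      change algebraMap B' (SnClosure n B' A') (φ (s B j a)) = _
      rw [← hs, algebraMap_s hj]
      rfl)).toRingHom

section

variable {n} (φ : B →+* B') (ψ : A →+* A')
  (hc : ∀ b, ψ (algebraMap B A b) = algebraMap B' A' (φ b))
  (hs : ∀ j a, s B' j (ψ a) = φ (s B j a))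

@[simp]
lemma map_algebraMap (b : B) :
    map n φ ψ hc hs (algebraMap B _ b) = algebraMap B' _ (φ b) := by
  let _ : Algebra B (SnClosure n B' A') :=
    ((algebraMap B' (SnClosure n B' A')).comp φ).toAlgebra
  exact AlgHom.commutes (lift (n := n) (B := B) (A := A) (C := SnClosure n B' A') _ _) b

@[simp]
lemma map_conj (i : Fin n) (a : A) :
    map n φ ψ hc hs (conj n B A i a) = conj n B' A' i (ψ a) := by
  let _ : Algebra B (SnClosure n B' A') :=
    ((algebraMap B' (SnClosure n B' A')).comp φ).toAlgebra
  exact lift_conj (n := n) (B := B) (A := A) (C := SnClosure n B' A') _ _ i a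

end

/-- The `S_n`-closure commutes with localization of the base. -/
lemma isLocalization_map [Algebra B B'] [Algebra A A'] [Algebra B A']
    [IsScalarTower B A A'] [IsScalarTower B B' A'] (b : B)
    [IsLocalization.Away b B'] [IsLocalization.Away (algebraMap B A b) A']
    (hc : ∀ b, algebraMap A A' (algebraMap B A b) = algebraMap B' A' (algebraMap B B' b))
    (hs : ∀ j a, s B' j (algebraMap A A' a) = algebraMap B B' (s B j a)) :
    letI := (map n (algebraMap B B') (algebraMap A A') hc hs).toAlgebra
    IsLocalization.Away (algebraMap B (SnClosure n B A) b) (SnClosure n B' A') := by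
  let _ : Algebra (SnClosure n B A) (SnClosure n B' A') :=
    (map n (algebraMap B B') (algebraMap A A') hc hs).toAlgebra
  let G := SnClosure n B A
  let G' := SnClosure n B' A'
  let M := map n (algebraMap B B') (algebraMap A A') hc hs
  let β : G := algebraMap B G b
  let L := Localization.Away β
  have hL : IsUnit (algebraMap B L b) := by
    rw [IsScalarTower.algebraMap_apply B G L]
    exact IsLocalization.Away.algebraMap_isUnit β
  let _ : Algebra B' L := (IsLocalization.Away.lift b (g := algebraMap B L) hL).toAlgebra
  have hB' : ∀ x : B, algebraMap B' L (algebraMap B B' x) = algebraMap B L x := fun x =>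
    IsLocalization.Away.lift_eq b hL x
  have hu : ∀ i, IsUnit (((algebraMap G L).comp (conj n B A i : A →+* G)) (algebraMap B A b)) := by
    intro i
    simp only [RingHom.comp_apply, RingHom.coe_coe, AlgHom.commutes]
    rwa [← IsScalarTower.algebraMap_apply B G L]
  let g₀ : Fin n → (A' →+* L) := fun i => IsLocalization.Away.lift (algebraMap B A b) (hu i)
  have hg₀ : ∀ i a, g₀ i (algebraMap A A' a) = algebraMap G L (conj n B A i a) := fun i a =>
    IsLocalization.Away.lift_eq _ (hu i) a
  have hg₀' : ∀ i, (g₀ i).comp (algebraMap B' A') = algebraMap B' L := by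
    intro i
    refine IsLocalization.ringHom_ext (Submonoid.powers b) (RingHom.ext fun x => ?_)
    simp only [RingHom.comp_apply]
    rw [hB', ← hc, hg₀, AlgHom.commutes, ← IsScalarTower.algebraMap_apply B G L]
  let g : Fin n → (A' →ₐ[B'] L) := fun i =>
    { g₀ i with commutes' := fun x => DFunLike.congr_fun (hg₀' i) x }
  have hg : ∀ i a, g i (algebraMap A A' a) = algebraMap G L (conj n B A i a) := hg₀
  have hrel : ∀ a, ∀ j ∈ Finset.Icc 1 n, algebraMap B' L (s B' j a) =
      ∑ t ∈ (Finset.univ : Finset (Fin n)).powersetCard j, ∏ i ∈ t, g i a := by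
    intro a' j hj
    obtain ⟨k, a, ha⟩ := IsLocalization.Away.surj (algebraMap B A b) a'
    let c : B' := algebraMap B B' b ^ k
    have hcu : IsUnit (algebraMap B' L c) := by
      rw [map_pow, hB']
      exact hL.pow k
    have hca : algebraMap A A' a = c • a' := by
      rw [← ha, Algebra.smul_def, mul_comm, map_pow, hc]
    have h1 : algebraMap B' L (s B' j (c • a')) =
        ∑ t ∈ (Finset.univ : Finset (Fin n)).powersetCard j, ∏ i ∈ t, g i (c • a') := by
      rw [← hca, hs, hB', IsScalarTower.algebraMap_apply B G L, algebraMap_s hj, map_sum]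
      simp_rw [map_prod, hg]
    refine (hcu.pow j).mul_left_cancel ?_
    rw [s_smul, map_mul, map_pow] at h1
    rw [h1, Finset.mul_sum]
    refine Finset.sum_congr rfl fun t ht => ?_
    rw [← (Finset.mem_powersetCard.1 ht).2]
    simp_rw [Algebra.smul_def, map_mul, AlgHom.commutes, Finset.prod_mul_distrib,
      Finset.prod_const]
  let χ : G' →ₐ[B'] L := lift g hrel
  have hM1 : ∀ y : B, M (algebraMap B G y) = algebraMap B' G' (algebraMap B B' y) :=
    map_algebraMap _ _ hc hs
  have hM2 : ∀ i a, M (conj n B A i a) = conj n B' A' i (algebraMap A A' a) :=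
    map_conj _ _ hc hs
  have hχ : ∀ i a, χ (conj n B' A' i a) = g i a := lift_conj g hrel
  have hχM : ∀ x : G, χ (M x) = algebraMap G L x := by
    intro x
    have : (χ : G' →+* L).comp M = algebraMap G L := by
      refine ringHom_ext (fun y => ?_) fun i a => ?_
      · change χ (M (algebraMap B G y)) = algebraMap G L (algebraMap B G y)
        rw [hM1, AlgHom.commutes, hB', IsScalarTower.algebraMap_apply B G L]
      · change χ (M (conj n B A i a)) = _
        rw [hM2, hχ, hg]
    exact DFunLike.congr_fun this x
  have hMu : IsUnit (M β) := by
    simp only [β, hM1]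
    exact (IsLocalization.Away.algebraMap_isUnit (S := B') b).map (algebraMap B' G')
  let ψ : L →+* G' := IsLocalization.Away.lift β hMu
  have hψ : ∀ x, ψ (algebraMap G L x) = M x := fun x => IsLocalization.Away.lift_eq β hMu x
  have h1 : (χ : G' →+* L).comp ψ = RingHom.id L := by
    refine IsLocalization.ringHom_ext (Submonoid.powers β) (RingHom.ext fun x => ?_)
    simp only [RingHom.comp_apply, hψ, RingHom.coe_coe, hχM, RingHom.id_apply]
  have h2B : (ψ.comp (algebraMap B' L)) = algebraMap B' G' := by
    refine IsLocalization.ringHom_ext (Submonoid.powers b) (RingHom.ext fun x => ?_)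
    simp only [RingHom.comp_apply]
    rw [hB', IsScalarTower.algebraMap_apply B G L, hψ]
    exact map_algebraMap _ _ hc hs x
  have h2 : ψ.comp (χ : G' →+* L) = RingHom.id G' := by
    refine ringHom_ext (fun y => ?_) fun i a => ?_
    · change ψ (χ (algebraMap B' G' y)) = _
      rw [AlgHom.commutes]
      exact DFunLike.congr_fun h2B y
    · have : (ψ.comp (g i : A' →+* L)) = (conj n B' A' i : A' →+* G') := by
        refine IsLocalization.ringHom_ext (Submonoid.powers (algebraMap B A b))
          (RingHom.ext fun x => ?_)
        simp only [RingHom.comp_apply, RingHom.coe_coe, hg, hψ]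
        exact map_conj _ _ hc hs i x
      change ψ (χ (conj n B' A' i a)) = _
      rw [hχ]
      exact DFunLike.congr_fun this a
  let e : L ≃+* G' := RingEquiv.ofRingHom ψ χ h2 h1
  exact IsLocalization.isLocalization_of_algEquiv (Submonoid.powers β)
    (AlgEquiv.ofRingEquiv (f := e) hψ)

end Localization

end SnClosure

open CategoryTheory Opposite AlgebraicGeometry AlgebraicGeometry.Scheme

namespace AlgebraicGeometry

variable (n : ℕ) {X Y : Scheme.{u}} (f : X ⟶ Y)

/-- For an open `U ⊆ Y`, the sections over `U` of `f_* 𝒪_X` as an algebra over those of `𝒪_Y`. -/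
abbrev appAlgebra (U : Y.Opens) : Algebra Γ(Y, U) Γ(X, f ⁻¹ᵁ U) := (f.app U).hom.toAlgebra

attribute [local instance] appAlgebra

/-- `f : X ⟶ Y` is an `n`-covering: `X` is the relative spectrum of an `𝒪_Y`-algebra which is
locally free of rank `n` as an `𝒪_Y`-module. That is, `f` is affine and the sections of
`f_* 𝒪_X` over any affine open `U` of `Y` are locally free of rank `n` over those of `𝒪_Y`. -/
structure IsCovering : Prop where
  isAffineHom : IsAffineHom f
  isLocallyFree : ∀ U : Y.Opens, IsAffineOpen U → SnClosure.IsLocallyFree n Γ(Y, U) Γ(X, f ⁻¹ᵁ U)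

end AlgebraicGeometry

namespace SnClosure

variable {n : ℕ} {X Y : Scheme.{u}} {f : X ⟶ Y}

attribute [local instance] appAlgebra

lemma app_res {U V : Y.Opens} (i : U ⟶ V) (b : Γ(Y, V)) :
    (X.presheaf.map (homOfLE (f.preimage_mono i.le)).op).hom (algebraMap Γ(Y, V) Γ(X, f ⁻¹ᵁ V) b) =
      algebraMap Γ(Y, U) Γ(X, f ⁻¹ᵁ U) ((Y.presheaf.map i.op).hom b) :=
  congr($(f.naturality i.op) b).symm

lemma isLocalization_res (hf : IsAffineHom f) {V : Y.Opens} (hV : IsAffineOpen V) (r : Γ(Y, V)) :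
    letI := (X.presheaf.map (homOfLE (f.preimage_mono (Y.basicOpen_le r))).op).hom.toAlgebra
    IsLocalization.Away (algebraMap Γ(Y, V) Γ(X, f ⁻¹ᵁ V) r) Γ(X, f ⁻¹ᵁ Y.basicOpen r) := by
  have h := (hV.preimage f).isLocalization_basicOpen (f.app V r)
  let inst : Algebra Γ(X, f ⁻¹ᵁ V) Γ(X, f ⁻¹ᵁ Y.basicOpen r) :=
    (X.presheaf.map (homOfLE (f.preimage_mono (Y.basicOpen_le r))).op).hom.toAlgebra
  let : Algebra Γ(X, f ⁻¹ᵁ V) Γ(X, X.basicOpen (f.app V r)) :=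
    (X.presheaf.map (homOfLE (X.basicOpen_le _)).op).hom.toAlgebra
  change IsLocalization.Away (f.app V r) Γ(X, f ⁻¹ᵁ Y.basicOpen r)
  dsimp +instances [inst]
  rw! (castMode := .all) [f.preimage_basicOpen r]
  exact h

lemma s_res (h : IsCovering n f) {U V : Y.AffineZariskiSite} (i : U ⟶ V) (j : ℕ)
    (a : Γ(X, f ⁻¹ᵁ V.1)) :
    s Γ(Y, U.1) j ((X.presheaf.map
        (homOfLE (f.preimage_mono (AffineZariskiSite.toOpens_mono i.le))).op).hom a) =
      (Y.presheaf.map (homOfLE (AffineZariskiSite.toOpens_mono i.le)).op).hom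
        (s Γ(Y, V.1) j a) := by
  obtain ⟨U, hU⟩ := U
  obtain ⟨V, hV⟩ := V
  obtain ⟨r, hr⟩ := i.le
  dsimp only [AffineZariskiSite.toOpens] at hr
  subst hr
  have hle := Y.basicOpen_le r
  let _ : Algebra Γ(Y, V) Γ(Y, Y.basicOpen r) := (Y.presheaf.map (homOfLE hle).op).hom.toAlgebra
  let _ : Algebra Γ(X, f ⁻¹ᵁ V) Γ(X, f ⁻¹ᵁ Y.basicOpen r) :=
    (X.presheaf.map (homOfLE (f.preimage_mono hle)).op).hom.toAlgebra
  let _ : Algebra Γ(Y, V) Γ(X, f ⁻¹ᵁ Y.basicOpen r) :=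
    ((algebraMap Γ(X, f ⁻¹ᵁ V) Γ(X, f ⁻¹ᵁ Y.basicOpen r)).comp
      (algebraMap Γ(Y, V) Γ(X, f ⁻¹ᵁ V))).toAlgebra
  have : IsScalarTower Γ(Y, V) Γ(X, f ⁻¹ᵁ V) Γ(X, f ⁻¹ᵁ Y.basicOpen r) := .of_algebraMap_eq' rfl
  have : IsScalarTower Γ(Y, V) Γ(Y, Y.basicOpen r) Γ(X, f ⁻¹ᵁ Y.basicOpen r) :=
    .of_algebraMap_eq fun x => app_res (homOfLE hle) x
  have : IsLocalization.Away r Γ(Y, Y.basicOpen r) := hV.isLocalization_basicOpen r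
  have : IsLocalization.Away (algebraMap Γ(Y, V) Γ(X, f ⁻¹ᵁ V) r) Γ(X, f ⁻¹ᵁ Y.basicOpen r) :=
    isLocalization_res h.isAffineHom hV r
  have := (h.isLocallyFree V hV).finite_projective.1
  have := (h.isLocallyFree V hV).finite_projective.2
  exact algebraMap_s_localization r Γ(Y, Y.basicOpen r) Γ(X, f ⁻¹ᵁ Y.basicOpen r) j a

/-- The sheaf of `𝒪_Y`-algebras `G(f_* 𝒪_X / 𝒪_Y)` on the affine opens of `Y`; its sections over
`U` are `G(Γ(X, f⁻¹ U) / Γ(Y, U))`. -/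
def sheaf (h : IsCovering n f) : Y.AffineZariskiSiteᵒᵖ ⥤ CommRingCat.{u} where
  obj U := .of (SnClosure n Γ(Y, U.unop.1) Γ(X, f ⁻¹ᵁ U.unop.1))
  map i := CommRingCat.ofHom (map n _ _
    (app_res (homOfLE (AffineZariskiSite.toOpens_mono i.unop.le))) (s_res h i.unop))
  map_id U := by
    ext1
    refine ringHom_ext (fun b => ?_) fun i a => ?_
    · exact (map_algebraMap _ _ (app_res (homOfLE (AffineZariskiSite.toOpens_mono le_rfl)))
        (s_res h (𝟙 U.unop)) b).trans (by simp)
    · exact (map_conj _ _ (app_res (homOfLE (AffineZariskiSite.toOpens_mono le_rfl)))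
        (s_res h (𝟙 U.unop)) i a).trans (by simp)
  map_comp {U V W} i j := by
    ext1
    refine ringHom_ext (fun b => ?_) fun k a => ?_
    · refine (map_algebraMap _ _ (app_res (homOfLE (AffineZariskiSite.toOpens_mono (i ≫ j).unop.le)))
        (s_res h (i ≫ j).unop) b).trans ?_
      rw [CommRingCat.hom_comp, RingHom.comp_apply, CommRingCat.hom_ofHom, CommRingCat.hom_ofHom,
        map_algebraMap, map_algebraMap]
      simp [← CommRingCat.comp_apply, ← Functor.map_comp]
      rfl
    · refine (map_conj _ _ (app_res (homOfLE (AffineZariskiSite.toOpens_mono (i ≫ j).unop.le)))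
        (s_res h (i ≫ j).unop) k a).trans ?_
      rw [CommRingCat.hom_comp, RingHom.comp_apply, CommRingCat.hom_ofHom, CommRingCat.hom_ofHom,
        map_conj, map_conj]
      simp [← CommRingCat.comp_apply, ← Functor.map_comp]
      rfl

/-- The structure map `𝒪_Y ⟶ G(f_* 𝒪_X / 𝒪_Y)`. -/
def sheafMap (h : IsCovering n f) :
    (AffineZariskiSite.toOpensFunctor Y).op ⋙ Y.presheaf ⟶ sheaf h where
  app U := CommRingCat.ofHom
    (algebraMap Γ(Y, U.unop.1) (SnClosure n Γ(Y, U.unop.1) Γ(X, f ⁻¹ᵁ U.unop.1)))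
  naturality {U V} i := by
    ext b
    exact (map_algebraMap _ _ (app_res (homOfLE (AffineZariskiSite.toOpens_mono i.unop.le)))
      (s_res h i.unop) b).symm

/-- `G(f_* 𝒪_X / 𝒪_Y)` is quasi-coherent. -/
lemma coequifibered_sheafMap (h : IsCovering n f) : (sheafMap h).Coequifibered := by
  refine AffineZariskiSite.coequifibered_iff_forall_isLocalizationAway.mpr fun V r => ?_
  obtain ⟨V, hV⟩ := V
  have hle := Y.basicOpen_le r
  let _ : Algebra Γ(Y, V) Γ(Y, Y.basicOpen r) := (Y.presheaf.map (homOfLE hle).op).hom.toAlgebra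
  let _ : Algebra Γ(X, f ⁻¹ᵁ V) Γ(X, f ⁻¹ᵁ Y.basicOpen r) :=
    (X.presheaf.map (homOfLE (f.preimage_mono hle)).op).hom.toAlgebra
  let _ : Algebra Γ(Y, V) Γ(X, f ⁻¹ᵁ Y.basicOpen r) :=
    ((algebraMap Γ(X, f ⁻¹ᵁ V) Γ(X, f ⁻¹ᵁ Y.basicOpen r)).comp
      (algebraMap Γ(Y, V) Γ(X, f ⁻¹ᵁ V))).toAlgebra
  have : IsScalarTower Γ(Y, V) Γ(X, f ⁻¹ᵁ V) Γ(X, f ⁻¹ᵁ Y.basicOpen r) := .of_algebraMap_eq' rfl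
  have : IsScalarTower Γ(Y, V) Γ(Y, Y.basicOpen r) Γ(X, f ⁻¹ᵁ Y.basicOpen r) :=
    .of_algebraMap_eq fun x => app_res (homOfLE hle) x
  have : IsLocalization.Away r Γ(Y, Y.basicOpen r) := hV.isLocalization_basicOpen r
  have : IsLocalization.Away (algebraMap Γ(Y, V) Γ(X, f ⁻¹ᵁ V) r) Γ(X, f ⁻¹ᵁ Y.basicOpen r) :=
    isLocalization_res h.isAffineHom hV r
  exact isLocalization_map n (B := Γ(Y, V)) (A := Γ(X, f ⁻¹ᵁ V)) (B' := Γ(Y, Y.basicOpen r))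
    (A' := Γ(X, f ⁻¹ᵁ Y.basicOpen r)) r (app_res (homOfLE hle))
    (s_res h (homOfLE (AffineZariskiSite.basicOpen_le ⟨V, hV⟩ r)))

end SnClosure

namespace AlgebraicGeometry.IsCovering

variable {n : ℕ} {X Y : Scheme.{u}} {f : X ⟶ Y}

/-- The gluing data of the schemes `Spec G(Γ(X, f⁻¹ U) / Γ(Y, U))` over the affine opens `U` of
`Y`. -/
def snClosureGluingData (h : IsCovering n f) :
    (AffineZariskiSite.directedCover Y).RelativeGluingData :=
  AffineZariskiSite.relativeGluingData (SnClosure.coequifibered_sheafMap h)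

/-- The `S_n`-closure `G(X/Y)` of an `n`-covering `f : X ⟶ Y`: the relative spectrum of
`G(f_* 𝒪_X / 𝒪_Y)` over `Y`. -/
def snClosure (h : IsCovering n f) : Scheme.{u} := h.snClosureGluingData.glued

/-- The structure morphism `G(X/Y) ⟶ Y`. -/
def snClosureMap (h : IsCovering n f) : h.snClosure ⟶ Y := h.snClosureGluingData.toBase

end AlgebraicGeometry.IsCovering

end

noncomputable section

/-! In the split case each `σ` gives a homomorphism `G(Bⁿ/B) → B`, `a^{(i)} ↦ a_{σ⁻¹(i)}`, because
`s_j` on `Bⁿ` is the elementary symmetric polynomial of the coordinates (`s_pi`). Together they form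
`toPi`, which sends `e_σ` to the indicator of `σ`. Conversely the `e_σ` span: the relation `s₁(ε_k)
= 1` kills every product `∏ᵢ ε_{f(i)}^{(i)}` with `f` not bijective (`prod_conj_eq_zero`), so `∑ e_σ
= 1`, and `G` acts on each `e_σ` by scalars.

The étale case is faithfully flat descent. A perfect trace form makes `A` étale (`IsEtale.etale`),
so `T ⊗ A ≅ Tⁿ` for some faithfully flat `T`. Then `T ⊗ G(A/B) ≅ G(Tⁿ/T) ≅ T^{n!}`
(`tensorEquivSplit`, `piEquiv`), and étaleness, rank and perfectness of the trace form descend to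
`G(A/B)`.

The delicate point is base change: relations for elements of `A` must imply those for sums of
tensors `t ⊗ a`, although `s_j` is not additive. This is `esymm_eq_of_closure_eq_top`.

For schemes everything is read off on affine opens `U`, over which `G(X/Y)` is the spectrum of the
`S_n`-closure of the sections. -/

namespace SnClosure

/-! ### Elementary symmetric functions of families of ring homomorphisms -/

open Polynomial in
lemma prod_map_one_add_X_pow_mul_C {n : ℕ} {R C : Type*} [CommRing R] [CommRing C]
    (p : Fin n → (R →+* C)) (d : ℕ) (a : R) :
    ∏ i, (1 + X ^ d * Polynomial.C a).map (p i) =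
      ∑ j ∈ Finset.range (n + 1), X ^ (d * j) *
        Polynomial.C (∑ t ∈ (Finset.univ : Finset (Fin n)).powersetCard j, ∏ i ∈ t, p i a) := by
  simp only [Polynomial.map_add, Polynomial.map_one, Polynomial.map_mul, Polynomial.map_pow,
    Polynomial.map_X, Polynomial.map_C]
  rw [Finset.prod_one_add, Finset.sum_powerset]
  simp only [Finset.card_univ, Fintype.card_fin]
  refine Finset.sum_congr rfl fun j _ => ?_
  rw [map_sum, Finset.mul_sum]
  refine Finset.sum_congr rfl fun t ht => ?_
  rw [Finset.prod_mul_distrib, Finset.prod_const, (Finset.mem_powersetCard.1 ht).2, ← pow_mul,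
    map_prod]

open Polynomial in
lemma prod_map_one_add_congr {n : ℕ} {R C : Type*} [CommRing R] [CommRing C]
    {p g : Fin n → (R →+* C)} {a : R}
    (h : ∀ j ∈ Finset.Icc 1 n, ∑ t ∈ (Finset.univ : Finset (Fin n)).powersetCard j, ∏ i ∈ t, p i a =
      ∑ t ∈ (Finset.univ : Finset (Fin n)).powersetCard j, ∏ i ∈ t, g i a) (d : ℕ) :
    ∏ i, (1 + X ^ d * Polynomial.C a).map (p i) = ∏ i, (1 + X ^ d * Polynomial.C a).map (g i) := by
  rw [prod_map_one_add_X_pow_mul_C, prod_map_one_add_X_pow_mul_C]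
  refine Finset.sum_congr rfl fun j hj => ?_
  -- The hypothesis omits `j = 0`, where both sums equal `1`.
  rcases Nat.eq_zero_or_pos j with rfl | hj0
  · simp
  · rw [h j (Finset.mem_Icc.2 ⟨hj0, Nat.lt_succ_iff.1 (Finset.mem_range.1 hj)⟩)]

open Polynomial in
/-- If the elementary symmetric functions of two families of `n` ring homomorphisms agree on a set
of additive generators, then they agree everywhere: modulo `X ^ d`, each polynomial `1 + X a` is a
product of polynomials `1 + X ^ k s` with `s` a generator. -/
lemma esymm_eq_of_closure_eq_top {n : ℕ} {R C : Type*} [CommRing R] [CommRing C]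
    (p g : Fin n → (R →+* C)) (S : Set R) (hS : AddSubmonoid.closure S = ⊤)
    (h : ∀ a ∈ S, ∀ j ∈ Finset.Icc 1 n,
      ∑ t ∈ (Finset.univ : Finset (Fin n)).powersetCard j, ∏ i ∈ t, p i a =
        ∑ t ∈ (Finset.univ : Finset (Fin n)).powersetCard j, ∏ i ∈ t, g i a)
    (a : R) (j : ℕ) :
    ∑ t ∈ (Finset.univ : Finset (Fin n)).powersetCard j, ∏ i ∈ t, p i a =
      ∑ t ∈ (Finset.univ : Finset (Fin n)).powersetCard j, ∏ i ∈ t, g i a := by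
  -- `E q` is multiplicative, and the coefficients of `E q (1 + X a)` are the elementary symmetric
  -- functions of the `q i a`; additivity in `a` is traded for multiplicativity in `f`.
  let E : (Fin n → (R →+* C)) → R[X] → C[X] := fun q f => ∏ i, f.map (q i)
  have E_mul : ∀ q f f', E q (f * f') = E q f * E q f' := fun q f f' => by
    simp [E, Finset.prod_mul_distrib]
  have E_congr : ∀ q (d : ℕ) (f f' : R[X]), X ^ d ∣ f - f' → (X : C[X]) ^ d ∣ E q f - E q f' := by
    intro q d f f' hd
    rw [← Ideal.mem_span_singleton, ← Ideal.Quotient.eq]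
    simp only [E, map_prod]
    refine Finset.prod_congr rfl fun i _ => ?_
    rw [Ideal.Quotient.eq, Ideal.mem_span_singleton, ← Polynomial.map_sub]
    simpa using Polynomial.map_dvd (q i) hd
  -- `(1 + X^d x)(1 + X^d y)` differs from `1 + X^d (x + y)` by `X^(2d) x y`, and `2d ≥ d + 1` since
  -- `d ≥ 1`.
  have lin : ∀ (d : ℕ), 1 ≤ d → ∀ c : R, ∃ v : R[X], E p v = E g v ∧
      X ^ (d + 1) ∣ v - (1 + X ^ d * Polynomial.C c) := by
    intro d hd c
    have hc : c ∈ AddSubmonoid.closure S := hS ▸ AddSubmonoid.mem_top c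
    induction hc using AddSubmonoid.closure_induction with
    | mem x hx => exact ⟨_, prod_map_one_add_congr (h x hx) d, by simp⟩
    | zero => exact ⟨1, by simp [E], by simp⟩
    | add x y _ _ hx hy =>
      obtain ⟨v, hv, r, hr⟩ := hx
      obtain ⟨w, hw, r', hr'⟩ := hy
      refine ⟨v * w, by rw [E_mul, E_mul, hv, hw], ?_⟩
      obtain ⟨k, rfl⟩ := Nat.exists_eq_add_of_le hd
      rw [sub_eq_iff_eq_add] at hr hr'
      refine ⟨r * w + (1 + X ^ (1 + k) * Polynomial.C x) * r' +
        X ^ k * Polynomial.C x * Polynomial.C y, ?_⟩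
      rw [hr', hr, map_add]
      ring
  -- Successive approximation: if `f - v = X^(d+1) r`, multiply `v` by some `w ≡ 1 + X^(d+1) r(0)`.
  -- As `v` has constant term `1`, this removes the leading error.
  have approx : ∀ (f : R[X]), X ∣ f - 1 → ∀ d : ℕ, ∃ v : R[X], E p v = E g v ∧
      X ∣ v - 1 ∧ X ^ (d + 1) ∣ f - v := by
    intro f hf d
    induction d with
    | zero => exact ⟨1, by simp [E], by simp, by simpa using hf⟩
    | succ d ih =>
      obtain ⟨v, hv, ⟨q, hq⟩, r, hr⟩ := ih
      obtain ⟨w, hw, r', hr'⟩ := lin (d + 1) (by omega) (r.coeff 0)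
      obtain ⟨r'', hr''⟩ : X ∣ r - Polynomial.C (r.coeff 0) := by
        rw [Polynomial.X_dvd_iff]
        simp
      rw [sub_eq_iff_eq_add] at hr hr' hr'' hq
      refine ⟨v * w, by rw [E_mul, E_mul, hv, hw], ?_, ?_⟩
      · refine ⟨X ^ (d + 1) * r' * v + X ^ d * Polynomial.C (r.coeff 0) * v + q, ?_⟩
        rw [hr', hq]
        ring
      · refine ⟨r'' - q * Polynomial.C (r.coeff 0) - v * r', ?_⟩
        rw [hr, hr']
        linear_combination X ^ (d + 1) * hr'' - X ^ (d + 1) * Polynomial.C (r.coeff 0) * hq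
  have key : E p (1 + X ^ 1 * Polynomial.C a) = E g (1 + X ^ 1 * Polynomial.C a) := by
    rw [← sub_eq_zero]
    ext d
    obtain ⟨v, hv, -, hd⟩ := approx (1 + X ^ 1 * Polynomial.C a) ⟨Polynomial.C a, by ring⟩ d
    have h1 := E_congr p _ _ _ hd
    have h2 := E_congr g _ _ _ hd
    have h3 : (X : C[X]) ^ (d + 1) ∣
        E p (1 + X ^ 1 * Polynomial.C a) - E g (1 + X ^ 1 * Polynomial.C a) := by
      have := dvd_sub h1 h2
      rwa [hv, sub_sub_sub_cancel_right] at this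
    exact Polynomial.X_pow_dvd_iff.1 h3 d (Nat.lt_succ_self d)
  by_cases hj : j ≤ n
  · have := congrArg (fun f => f.coeff j) key
    simp only [E, prod_map_one_add_X_pow_mul_C, Polynomial.finsetSum_coeff, one_mul,
      Polynomial.coeff_X_pow_mul', Polynomial.coeff_C] at this
    rw [Finset.sum_eq_single j, Finset.sum_eq_single j] at this
    · simpa using this
    all_goals simp +contextual [Nat.sub_eq_zero_iff_le]
    all_goals omega
  · rw [Finset.powersetCard_eq_empty.2 (by simpa using hj)]
    simp

/-! ### Generators of the closure as a module -/

lemma mk_tprod {n : ℕ} {B A : Type*} [CommRing B] [CommRing A] [Algebra B A] (c : Fin n → A) :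
    (Ideal.Quotient.mk (ideal n B A) (PiTensorProduct.tprod B c) : SnClosure n B A) =
      ∏ i, conj n B A i (c i) := by
  have : c = ∏ i, Pi.mulSingle i (c i) := by
    simpa using (Finset.univ_prod_mulSingle c).symm
  conv_lhs => rw [this, PiTensorProduct.tprod_prod, map_prod]
  rfl

/-- `G(A/B)` is spanned by the products `∏ᵢ cᵢ^{(i)}`. -/
@[elab_as_elim]
lemma induction_on {n : ℕ} {B A : Type*} [CommRing B] [CommRing A] [Algebra B A]
    {P : SnClosure n B A → Prop} (x : SnClosure n B A)
    (prod : ∀ (r : B) (c : Fin n → A), P (r • ∏ i, conj n B A i (c i)))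
    (add : ∀ x y, P x → P y → P (x + y)) : P x := by
  obtain ⟨x, rfl⟩ := Ideal.Quotient.mk_surjective x
  induction x using PiTensorProduct.induction_on with
  | smul_tprod r c =>
    have h := prod r c
    rw [← mk_tprod] at h
    exact h
  | add x y hx hy => exact map_add (Ideal.Quotient.mk (ideal n B A)) x y ▸ add _ _ hx hy

/-! ### The split algebra `Bⁿ` -/

section Split

variable {n : ℕ} {B : Type*} [CommRing B]

/-- Multiplication by `x` is diagonal in the standard basis, so the principal minor indexed by `S`
is `∏_{i ∈ S} x i`. -/
lemma s_pi (j : ℕ) (x : Fin n → B) :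
    s B j x = ∑ t ∈ (Finset.univ : Finset (Fin n)).powersetCard j, ∏ i ∈ t, x i := by
  rw [s_eq_sum (fun k => LinearMap.proj k) (fun k => Pi.single k 1)
    (fun y => by
      conv_rhs => rw [pi_eq_sum_univ' y]
      simp)]
  have h : ∀ S : Set.powersetCard (Fin n) j,
      (Matrix.of fun i k => (LinearMap.proj (Set.powersetCard.ofFinEmbEquiv.symm S k) :
        (Fin n → B) →ₗ[B] B)
        (x * (Pi.single (Set.powersetCard.ofFinEmbEquiv.symm S i) 1 : Fin n → B))).det =
      ∏ i ∈ S.1, x i := by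
    intro S
    have : (Matrix.of fun i k => (LinearMap.proj (Set.powersetCard.ofFinEmbEquiv.symm S k) :
        (Fin n → B) →ₗ[B] B)
        (x * (Pi.single (Set.powersetCard.ofFinEmbEquiv.symm S i) 1 : Fin n → B))) =
        Matrix.diagonal fun i => x (Set.powersetCard.ofFinEmbEquiv.symm S i) := by
      ext i k
      by_cases hik : i = k
      · subst hik
        simp
      · simp [hik, Pi.single_apply, Ne.symm hik]
    rw [this, Matrix.det_diagonal]
    refine Finset.prod_bij (fun i _ => Set.powersetCard.ofFinEmbEquiv.symm S i) (fun i _ => ?_)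
      (fun i _ k _ h => (Set.powersetCard.ofFinEmbEquiv.symm S).injective h) (fun k hk => ?_)
      fun _ _ => rfl
    · exact (Set.powersetCard.mem_range_ofFinEmbEquiv_symm_iff_mem S _).1 ⟨i, rfl⟩
    · obtain ⟨i, hi⟩ := (Set.powersetCard.mem_range_ofFinEmbEquiv_symm_iff_mem S k).2 hk
      exact ⟨i, Finset.mem_univ i, hi⟩
  simp_rw [h]
  exact Finset.sum_bij (fun S _ => S.1) (fun S _ => by simp)
    (fun S _ T _ hST => Subtype.ext hST)
    (fun t ht => ⟨⟨t, (Finset.mem_powersetCard.1 ht).2⟩, Finset.mem_univ _, rfl⟩) fun _ _ => rfl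

variable (n B)

lemma algebraMap_s_pi_perm (σ : Equiv.Perm (Fin n)) (a : Fin n → B) (j : ℕ)
    (_ : j ∈ Finset.Icc 1 n) :
    algebraMap B B (s B j a) = ∑ t ∈ (Finset.univ : Finset (Fin n)).powersetCard j,
      ∏ i ∈ t, Pi.evalAlgHom B (fun _ => B) (σ⁻¹ i) a := by
  rw [s_pi, Algebra.algebraMap_self, RingHom.id_apply]
  refine Finset.sum_equiv (Equiv.finsetCongr σ) ?_ ?_
  · intro t
    simp [Finset.mem_powersetCard]
  · intro t _
    simp [Finset.prod_map]

/-- The homomorphism `G(Bⁿ/B) → B` with `a^{(i)} ↦ a_{σ⁻¹(i)}`. -/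
def evalPerm (σ : Equiv.Perm (Fin n)) : SnClosure n B (Fin n → B) →ₐ[B] B :=
  lift (fun i => Pi.evalAlgHom B (fun _ => B) (σ⁻¹ i)) (algebraMap_s_pi_perm n B σ)

/-- The homomorphism `G(Bⁿ/B) → ∏_{σ ∈ S_n} B` with components `a^{(i)} ↦ a_{σ⁻¹(i)}`. -/
def toPi : SnClosure n B (Fin n → B) →ₐ[B] (Equiv.Perm (Fin n) → B) :=
  AlgHom.pi (evalPerm n B)

/-- The element `e_σ = ∏ᵢ eᵢ^{(σ(i))}` of `G(Bⁿ/B)`. -/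
def permIdempotent (σ : Equiv.Perm (Fin n)) : SnClosure n B (Fin n → B) :=
  ∏ i, conj n B (Fin n → B) (σ i) (Pi.single i 1)

variable {n B}

lemma toPi_conj (i : Fin n) (a : Fin n → B) (σ : Equiv.Perm (Fin n)) :
    toPi n B (conj n B (Fin n → B) i a) σ = a (σ⁻¹ i) :=
  lift_conj (fun i => Pi.evalAlgHom B (fun _ => B) (σ⁻¹ i)) (algebraMap_s_pi_perm n B σ) i a

/-- At `τ`, the `i`-th factor of `e_σ` becomes the `τ⁻¹(σ(i))`-th coordinate of `ε_i`, which
vanishes unless `τ i = σ i`. -/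
lemma toPi_permIdempotent (σ : Equiv.Perm (Fin n)) :
    toPi n B (permIdempotent n B σ) = Pi.single σ 1 := by
  ext τ
  rw [permIdempotent, map_prod, Finset.prod_apply]
  simp_rw [toPi_conj]
  by_cases h : τ = σ
  · subst h
    simp
  · rw [Pi.single_eq_of_ne h]
    obtain ⟨i, hi⟩ : ∃ i, τ i ≠ σ i := by
      by_contra! hc
      exact h (Equiv.ext hc)
    refine Finset.prod_eq_zero (Finset.mem_univ i) (Pi.single_eq_of_ne ?_ _)
    rw [Ne, Equiv.Perm.inv_eq_iff_eq]
    exact fun h => hi h.symm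

/-- For `i = σ k`, the product `e_σ` contains the factor `ε_k^{(i)}`, and `a ε_k = a_k ε_k` in `Bⁿ`.
-/
lemma conj_mul_permIdempotent (σ : Equiv.Perm (Fin n)) (i : Fin n) (a : Fin n → B) :
    conj n B (Fin n → B) i a * permIdempotent n B σ = a (σ⁻¹ i) • permIdempotent n B σ := by
  obtain ⟨k, rfl⟩ := σ.surjective i
  rw [show σ⁻¹ (σ k) = k from σ.symm_apply_apply k, permIdempotent,
    ← Finset.mul_prod_erase Finset.univ _ (Finset.mem_univ k), ← mul_assoc, ← map_mul,
    ← smul_mul_assoc, ← map_smul]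
  congr 2
  ext l
  by_cases h : l = k
  · subst h
    simp
  · simp [h]

/-- If `f` misses `k`, multiply by `1 = s₁(ε_k) = ∑ᵢ ε_k^{(i)}`: the `i`-th term dies because `ε_k
ε_{f(i)} = 0`. -/
lemma prod_conj_eq_zero {f : Fin n → Fin n} (hf : ¬ Function.Bijective f) :
    ∏ i, conj n B (Fin n → B) i (Pi.single (f i) 1) = 0 := by
  obtain ⟨k, hk⟩ : ∃ k, ∀ i, f i ≠ k := by
    have : ¬ Function.Surjective f := fun h => hf ⟨Finite.injective_iff_surjective.2 h, h⟩
    simpa [Function.Surjective] using this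
  -- The missed index `k` forces `n ≥ 1`, so the relation for `j = 1` is available.
  have hn : 1 ∈ Finset.Icc 1 n := Finset.mem_Icc.2 ⟨le_rfl, Nat.one_le_iff_ne_zero.2 fun h => by
    subst h; exact k.elim0⟩
  have h1 := algebraMap_s (n := n) (B := B) hn (Pi.single k (1 : B) : Fin n → B)
  rw [s_pi, Finset.powersetCard_one] at h1
  simp only [Finset.sum_map, Function.Embedding.coeFn_mk, Finset.prod_singleton] at h1
  rw [Fintype.sum_pi_single' k (1 : B), map_one] at h1
  rw [← one_mul (∏ i, _), h1, Finset.sum_mul]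
  refine Finset.sum_eq_zero fun i _ => ?_
  rw [← Finset.mul_prod_erase Finset.univ _ (Finset.mem_univ i), ← mul_assoc, ← map_mul]
  have : (Pi.single k 1 * Pi.single (f i) 1 : Fin n → B) = 0 := by
    ext l
    by_cases h : l = k
    · subst h
      simp [Ne.symm (hk i)]
    · simp [h]
  rw [this, map_zero, zero_mul]

/-- Expand `1 = ∏ᵢ ∑_k ε_k^{(i)}`; only the terms of bijective `f` survive, and `f = σ⁻¹`
contributes `e_σ`. -/
lemma sum_permIdempotent : ∑ σ, permIdempotent n B σ = 1 := by
  have h1 : (1 : SnClosure n B (Fin n → B)) =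
      ∏ i, ∑ k, conj n B (Fin n → B) i (Pi.single k 1) := by
    simp_rw [← map_sum]
    rw [Finset.univ_sum_single (fun _ : Fin n => (1 : B))]
    exact (Finset.prod_eq_one fun i _ => map_one (conj n B (Fin n → B) i)).symm
  rw [h1, Finset.prod_univ_sum, Fintype.piFinset_univ]
  refine Fintype.sum_of_injective (fun σ : Equiv.Perm (Fin n) => (⇑(σ⁻¹) : Fin n → Fin n))
    (fun σ τ h => inv_injective (DFunLike.coe_injective h)) _ _ (fun f hf => ?_) fun σ => ?_
  · exact prod_conj_eq_zero fun h => hf ⟨(Equiv.ofBijective f h)⁻¹, by ext; simp⟩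
  · exact Fintype.prod_equiv σ _ _ fun i => by simp

lemma mul_permIdempotent (σ : Equiv.Perm (Fin n)) (x : SnClosure n B (Fin n → B)) :
    x * permIdempotent n B σ = toPi n B x σ • permIdempotent n B σ := by
  induction x using induction_on with
  | prod r c =>
    rw [map_smul, Pi.smul_apply, smul_assoc, smul_mul_assoc, map_prod, Finset.prod_apply]
    congr 1
    induction (Finset.univ : Finset (Fin n)) using Finset.induction_on with
    | empty => simp
    | insert i t hi ih =>
      rw [Finset.prod_insert hi, Finset.prod_insert hi, mul_assoc, ih, mul_smul_comm,
        conj_mul_permIdempotent, toPi_conj, smul_smul, mul_comm]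
  | add x y hx hy =>
    rw [add_mul, hx, hy, map_add, Pi.add_apply]
    exact (add_smul (toPi n B x σ) (toPi n B y σ) (permIdempotent n B σ)).symm

/-- This yields injectivity of `toPi`; surjectivity comes from `toPi_permIdempotent`. -/
lemma sum_toPi_smul (x : SnClosure n B (Fin n → B)) :
    ∑ σ, toPi n B x σ • permIdempotent n B σ = x := by
  simp_rw [← mul_permIdempotent]
  rw [← Finset.mul_sum, sum_permIdempotent, mul_one]

variable (n B)

/-- `G(Bⁿ/B)` is isomorphic to the product of copies of `B` indexed by `S_n`. -/
def piEquiv : SnClosure n B (Fin n → B) ≃ₐ[B] (Equiv.Perm (Fin n) → B) :=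
  AlgEquiv.ofBijective (toPi n B) ⟨fun x y h => by
    rw [← sum_toPi_smul x, ← sum_toPi_smul y, h], fun y => ⟨∑ σ, y σ • permIdempotent n B σ, by
      simp only [map_sum, map_smul, toPi_permIdempotent]
      ext τ
      simp [Pi.single_apply]⟩⟩

/-- The basis `(e_σ)` of `G(Bⁿ/B)`. -/
def permBasis : Module.Basis (Equiv.Perm (Fin n)) B (SnClosure n B (Fin n → B)) :=
  Module.Basis.ofEquivFun (piEquiv n B).toLinearEquiv

variable {n B}

lemma permBasis_apply (σ : Equiv.Perm (Fin n)) : permBasis n B σ = permIdempotent n B σ := by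
  rw [permBasis, Module.Basis.coe_ofEquivFun]
  exact (AlgEquiv.symm_apply_eq (piEquiv n B)).2 (toPi_permIdempotent (B := B) σ).symm

lemma completeOrthogonalIdempotents_permBasis :
    CompleteOrthogonalIdempotents (permBasis n B) := by
  have := (CompleteOrthogonalIdempotents.single (fun _ : Equiv.Perm (Fin n) => B)).map
    ((piEquiv n B).symm : (Equiv.Perm (Fin n) → B) →+* SnClosure n B (Fin n → B))
  convert this using 1
  ext σ
  simp [permBasis]

lemma action_permIdempotent (g σ : Equiv.Perm (Fin n)) :
    action n B (Fin n → B) g (permIdempotent n B σ) = permIdempotent n B (g * σ) := by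
  simp [action, permIdempotent]

end Split

end SnClosure

/-- The structure of `G(Bⁿ/B)`: it has a basis of orthogonal idempotents permuted simply
transitively by `S_n`. -/
theorem SnClosure.exists_basis_pi (n : ℕ) (B : Type u) [CommRing B] :
      ∃ e : Module.Basis (Equiv.Perm (Fin n)) B (SnClosure n B (Fin n → B)),
        (∀ σ, e σ = ∏ i, SnClosure.conj n B (Fin n → B) (σ i) (Pi.single i 1)) ∧
        CompleteOrthogonalIdempotents e ∧
        (∀ g σ, SnClosure.action n B (Fin n → B) g (e σ) = e (g * σ)) ∧
        Nonempty (SnClosure n B (Fin n → B) ≃ₐ[B] (Fin n.factorial → B)) ∧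
        ∃ φ : SnClosure n B (Fin n → B) ≃ₗ[B] MonoidAlgebra B (Equiv.Perm (Fin n)),
          (∀ σ, φ (e σ) = MonoidAlgebra.single σ 1) ∧
          ∀ g x, φ (SnClosure.action n B (Fin n → B) g x) = MonoidAlgebra.single g 1 * φ x := by
  have hact : ∀ g σ, action n B (Fin n → B) g (permBasis n B σ) = permBasis n B (g * σ) :=
    fun g σ => by rw [permBasis_apply, permBasis_apply, action_permIdempotent]
  let φ : SnClosure n B (Fin n → B) ≃ₗ[B] MonoidAlgebra B (Equiv.Perm (Fin n)) :=
    (permBasis n B).repr.trans (MonoidAlgebra.coeffLinearEquiv B).symm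
  have hφ : ∀ σ, φ (permBasis n B σ) = MonoidAlgebra.single σ 1 := fun σ => by
    simp [φ]
  refine ⟨permBasis n B, permBasis_apply, completeOrthogonalIdempotents_permBasis, hact,
    ⟨(piEquiv n B).trans (AlgEquiv.piCongrLeft B (fun _ => B)
      (Fintype.equivFinOfCardEq (by simp [Fintype.card_perm])))⟩, φ, hφ, fun g x => ?_⟩
  have : φ.toLinearMap ∘ₗ (action n B (Fin n → B) g).toLinearMap =
      LinearMap.mulLeft B (MonoidAlgebra.single g 1) ∘ₗ φ.toLinearMap := by
    refine (permBasis n B).ext fun σ => ?_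
    simp [hφ, hact]
  exact DFunLike.congr_fun this x

namespace SnClosure

/-! ### Base change of the `s_j` -/

section BaseChange

variable {B T A A' : Type*} [CommRing B] [CommRing T] [Algebra B T] [CommRing A] [Algebra B A]
  [CommRing A'] [Algebra T A']

/-- The base change of a dual basis along `B → T`. -/
lemma exists_dual_basis_baseChange (e : T ⊗[B] A ≃ₗ[T] A') {r : ℕ} (φ : Fin r → Module.Dual B A)
    (m : Fin r → A) (h : ∀ x, ∑ k, φ k x • m k = x) :
    ∃ φ' : Fin r → Module.Dual T A', (∀ k a, φ' k (e (1 ⊗ₜ a)) = algebraMap B T (φ k a)) ∧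
      ∀ x, ∑ k, φ' k x • e (1 ⊗ₜ m k) = x := by
  let φ' : Fin r → Module.Dual T A' := fun k =>
    (φ k).baseChange T ∘ₗ e.symm.toLinearMap
  have hφ : ∀ k t a, φ' k (e (t ⊗ₜ a)) = φ k a • t := fun k t a => by simp [φ']
  refine ⟨φ', fun k a => by rw [hφ, Algebra.smul_def, mul_one], fun x => ?_⟩
  obtain ⟨x, rfl⟩ := e.surjective x
  induction x using TensorProduct.induction_on with
  | zero => simp
  | tmul t a =>
    simp_rw [hφ, ← map_smul, ← map_sum]
    congr 1
    conv_rhs => rw [← h a, TensorProduct.tmul_sum]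
    refine Finset.sum_congr rfl fun k _ => ?_
    rw [TensorProduct.smul_tmul', smul_eq_mul, mul_one, TensorProduct.smul_tmul]
  | add x y hx hy => simp_rw [map_add, add_smul, Finset.sum_add_distrib, hx, hy]

/-- By `s_eq_sum`, `s_j` is a sum of minors built from a dual basis, and a dual basis survives base
change. -/
lemma s_baseChange [Module.Finite B A] [Module.Projective B A] (e : T ⊗[B] A ≃ₐ[T] A') (j : ℕ)
    (a : A) : s T j (e (1 ⊗ₜ a)) = algebraMap B T (s B j a) := by
  obtain ⟨r, φ, m, h⟩ := exists_dual_basis (B := B) (A := A)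
  obtain ⟨φ', hφ, h'⟩ := exists_dual_basis_baseChange e.toLinearEquiv φ m h
  simp only [AlgEquiv.toLinearEquiv_apply] at hφ h'
  rw [s_eq_sum φ m h, s_eq_sum φ' _ h', map_sum]
  refine Finset.sum_congr rfl fun S _ => ?_
  rw [RingHom.map_det]
  congr 1
  ext x y
  simp [← hφ, ← map_mul]

end BaseChange

/-! ### Base change of the closure to a splitting ring -/

section SplitBaseChange

variable {n : ℕ} {B T A : Type*} [CommRing B] [CommRing T] [Algebra B T] [CommRing A] [Algebra B A]

/-- The extension of an algebra homomorphism `A → C` to `Tⁿ`, if `T ⊗ A` is isomorphic to `Tⁿ`. -/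
def extendToPi {C : Type*} [CommRing C] [Algebra T C] [Algebra B C] [IsScalarTower B T C]
    (e : T ⊗[B] A ≃ₐ[T] (Fin n → T)) (c : A →ₐ[B] C) : (Fin n → T) →ₐ[T] C :=
  (Algebra.TensorProduct.lift (Algebra.ofId T C) c fun _ _ => Commute.all _ _).comp e.symm.toAlgHom

lemma extendToPi_apply {C : Type*} [CommRing C] [Algebra T C] [Algebra B C] [IsScalarTower B T C]
    (e : T ⊗[B] A ≃ₐ[T] (Fin n → T)) (c : A →ₐ[B] C) (t : T) (a : A) :
    extendToPi e c (e (t ⊗ₜ a)) = algebraMap T C t * c a := by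
  simp [extendToPi, Algebra.ofId_apply]

variable [Module.Finite B A] [Module.Projective B A]

/-- If `T ⊗ A` is isomorphic to `Tⁿ`, then there is a map `T ⊗ G(A/B) → G(Tⁿ/T)`. -/
def tensorToSplit (e : T ⊗[B] A ≃ₐ[T] (Fin n → T)) :
    T ⊗[B] SnClosure n B A →ₐ[T] SnClosure n T (Fin n → T) :=
  Algebra.TensorProduct.lift (Algebra.ofId T _)
    (lift (fun i => ((conj n T (Fin n → T) i).restrictScalars B).comp
      ((e.toAlgHom.restrictScalars B).comp Algebra.TensorProduct.includeRight))
      fun a j hj => by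
        rw [IsScalarTower.algebraMap_apply B T, ← s_baseChange e, algebraMap_s hj]
        rfl)
    fun _ _ => Commute.all _ _

lemma tensorToSplit_conj (e : T ⊗[B] A ≃ₐ[T] (Fin n → T)) (i : Fin n) (a : A) :
    tensorToSplit e (1 ⊗ₜ conj n B A i a) = conj n T (Fin n → T) i (e (1 ⊗ₜ a)) := by
  simp [tensorToSplit]

/-- This makes `splitLift` well defined. On tensors `t ⊗ a` the relation follows from `s_j(ta) = t^j
s_j(a)`; these tensors generate additively, so `esymm_eq_of_closure_eq_top` gives the rest. -/
lemma algebraMap_s_extendToPi {C : Type*} [CommRing C] [Algebra T C] [Algebra B C]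
    [IsScalarTower B T C] (e : T ⊗[B] A ≃ₐ[T] (Fin n → T)) (c : Fin n → (A →ₐ[B] C))
    (hc : ∀ a, ∀ j ∈ Finset.Icc 1 n, algebraMap B C (s B j a) =
      ∑ t ∈ (Finset.univ : Finset (Fin n)).powersetCard j, ∏ i ∈ t, c i a)
    (x : Fin n → T) (j : ℕ) (_ : j ∈ Finset.Icc 1 n) :
    algebraMap T C (s T j x) =
      ∑ t ∈ (Finset.univ : Finset (Fin n)).powersetCard j, ∏ i ∈ t, extendToPi e (c i) x := by
  -- By `s_pi` the left side is also an elementary symmetric function of ring homomorphisms, namely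
  -- of the coordinate projections.
  let p : Fin n → ((Fin n → T) →+* C) := fun i =>
    (algebraMap T C).comp (Pi.evalRingHom (fun _ => T) i)
  let g : Fin n → ((Fin n → T) →+* C) := fun i => (extendToPi e (c i)).toRingHom
  have hp : ∀ x : Fin n → T, ∀ j, algebraMap T C (s T j x) =
      ∑ t ∈ (Finset.univ : Finset (Fin n)).powersetCard j, ∏ i ∈ t, p i x := fun x j => by
    rw [s_pi, map_sum]
    simp_rw [map_prod]
    rfl
  rw [hp]
  let S : Set (Fin n → T) := Set.range fun y : T × A => e (y.1 ⊗ₜ y.2)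
  have hS : AddSubmonoid.closure S = ⊤ := by
    rw [eq_top_iff]
    rintro x -
    obtain ⟨x, rfl⟩ := e.surjective x
    induction x using TensorProduct.induction_on with
    | zero => rw [map_zero]; exact zero_mem _
    | tmul t a => exact AddSubmonoid.subset_closure ⟨(t, a), rfl⟩
    | add x y hx hy => rw [map_add]; exact add_mem hx hy
  refine esymm_eq_of_closure_eq_top p g S hS ?_ x j
  rintro _ ⟨⟨t, a⟩, rfl⟩ j hj
  have hta : e (t ⊗ₜ a) = t • e (1 ⊗ₜ a) := by
    rw [← map_smul, TensorProduct.smul_tmul', smul_eq_mul, mul_one]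
  have hg : ∀ i, g i (e (t ⊗ₜ a)) = algebraMap T C t * c i a := fun i => extendToPi_apply e _ t a
  rw [← hp]
  dsimp only
  simp_rw [hg]
  rw [hta, s_smul, s_baseChange, map_mul, map_pow, ← IsScalarTower.algebraMap_apply, hc a j hj,
    Finset.mul_sum]
  refine Finset.sum_congr rfl fun t' ht => ?_
  rw [Finset.prod_mul_distrib, Finset.prod_const, (Finset.mem_powersetCard.1 ht).2]

/-- The homomorphism `G(Tⁿ/T) → C` of `T`-algebras induced by `G(A/B) → C`. -/
def splitLift {C : Type*} [CommRing C] [Algebra T C] [Algebra B C] [IsScalarTower B T C]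
    (e : T ⊗[B] A ≃ₐ[T] (Fin n → T)) (f : SnClosure n B A →ₐ[B] C) :
    SnClosure n T (Fin n → T) →ₐ[T] C :=
  lift (fun i => extendToPi e (f.comp (conj n B A i)))
    (algebraMap_s_extendToPi e _ fun a j hj => by
      rw [← f.commutes, algebraMap_s hj, map_sum]
      simp_rw [map_prod]
      rfl)

lemma splitLift_conj {C : Type*} [CommRing C] [Algebra T C] [Algebra B C] [IsScalarTower B T C]
    (e : T ⊗[B] A ≃ₐ[T] (Fin n → T)) (f : SnClosure n B A →ₐ[B] C) (i : Fin n) (a : A) :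
    splitLift e f (conj n T (Fin n → T) i (e (1 ⊗ₜ a))) = f (conj n B A i a) := by
  rw [splitLift, lift_conj, extendToPi_apply, map_one, one_mul]
  rfl

/-- If `T ⊗ A` is isomorphic to `Tⁿ`, then `T ⊗ G(A/B)` is isomorphic to `G(Tⁿ/T)`. -/
def tensorEquivSplit (e : T ⊗[B] A ≃ₐ[T] (Fin n → T)) :
    T ⊗[B] SnClosure n B A ≃ₐ[T] SnClosure n T (Fin n → T) :=
  AlgEquiv.ofAlgHom (tensorToSplit e) (splitLift (C := T ⊗[B] SnClosure n B A) e
      Algebra.TensorProduct.includeRight)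
    (algHom_ext (C := SnClosure n T (Fin n → T)) fun i x => by
      -- After transport along `e`, `T`-algebra maps out of `T ⊗ A` are determined on the elements
      -- `1 ⊗ a`.
      have : ((tensorToSplit e).comp (splitLift (C := T ⊗[B] SnClosure n B A) e
          Algebra.TensorProduct.includeRight)).comp
          ((conj n T (Fin n → T) i).comp e.toAlgHom) =
          (conj n T (Fin n → T) i).comp e.toAlgHom := by
        ext a
        simp [splitLift_conj, tensorToSplit_conj]
      obtain ⟨x, rfl⟩ := e.surjective x
      exact DFunLike.congr_fun this x)
    (by
      refine Algebra.TensorProduct.ext (Subsingleton.elim _ _) ?_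
      refine algHom_ext (C := T ⊗[B] SnClosure n B A) fun i a => ?_
      simp [splitLift_conj, tensorToSplit_conj])

end SplitBaseChange

/-! ### The trace form and étaleness -/

section TraceForm

variable {B A : Type*} [CommRing B] [CommRing A] [Algebra B A]

lemma traceMap_apply_eq_sum [Module.Finite B A] [Module.Projective B A] {r : ℕ}
    (φ : Fin r → Module.Dual B A) (m : Fin r → A) (h : ∀ x, ∑ k, φ k x • m k = x) (a b : A) :
    traceMap B A a b = ∑ k, φ k (a * b * m k) := by
  have hb : Function.Bijective (dualTensorHom B A A) := (dualTensorHomEquiv B A A).bijective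
  refine trace_eq_sum hb Finset.univ φ (fun k => a * b * m k) _ fun x => ?_
  conv_lhs => rw [← h x]
  simp

/-- The trace form becomes `∑ x_k y_k`, for which the standard basis is its own dual basis. -/
lemma isEtale_of_algEquiv_pi {ι : Type*} [Finite ι] (e : A ≃ₐ[B] (ι → B)) : IsEtale B A := by
  classical
  obtain ⟨m, ⟨f⟩⟩ := Finite.exists_equiv_fin ι
  let e' : A ≃ₐ[B] (Fin m → B) := e.trans (AlgEquiv.piCongrLeft B (fun _ => B) f)
  have : Module.Free B A := Module.Free.of_equiv e'.symm.toLinearEquiv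
  have : Module.Finite B A := Module.Finite.equiv e'.symm.toLinearEquiv
  have h : ∀ x, ∑ k, (LinearMap.proj k ∘ₗ e'.toLinearMap : Module.Dual B A) x •
      e'.symm (Pi.single k 1) = x := fun x => by
    apply e'.injective
    conv_rhs => rw [pi_eq_sum_univ' (e' x)]
    simp
  have key : ∀ a b, traceMap B A a b = ∑ k, e' a k * e' b k := fun a b => by
    rw [traceMap_apply_eq_sum _ _ h]
    simp
  refine ⟨(injective_iff_map_eq_zero _).2 fun a ha => ?_, fun ψ => ?_⟩
  · apply e'.injective
    ext k
    have := DFunLike.congr_fun ha (e'.symm (Pi.single k 1))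
    rw [key] at this
    simpa [Pi.single_apply] using this
  · refine ⟨e'.symm fun k => ψ (e'.symm (Pi.single k 1)), LinearMap.ext fun x => ?_⟩
    rw [key]
    conv_rhs => rw [← h x]
    simp [mul_comm]

/-- A finite projective algebra with perfect trace form is étale: the Casimir element of the trace
form is a separability idempotent. -/
lemma IsEtale.etale [Module.Finite B A] [Module.Projective B A] (h : IsEtale B A) :
    Algebra.Etale B A := by
  obtain ⟨r, φ, m, hm⟩ := exists_dual_basis (B := B) (A := A)
  -- `d k` represents `φ k`: `Tr(d_k x) = φ_k(x)`. The Casimir element is `∑ m_k ⊗ d_k`.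
  choose d hd using fun k => h.2 (φ k)
  have htr := traceMap_apply_eq_sum φ m hm
  have hmul : ∀ a b c, traceMap B A (a * b) c = traceMap B A a (b * c) := fun a b c => by
    rw [htr, htr, mul_assoc a]
  -- Both sides represent the trace: `Tr(x) = ∑ φ_k(x m_k) = ∑ Tr(d_k m_k x)`.
  have h1 : ∑ k, m k * d k = 1 := by
    apply h.1
    ext x
    simp only [map_sum, LinearMap.sum_apply]
    rw [htr 1]
    refine Finset.sum_congr rfl fun k _ => ?_
    rw [mul_comm, hmul, hd, one_mul, mul_comm]
  -- Both sides represent `x ↦ φ_l(a x)`. This identity lets `a` pass from one tensor factor of the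
  -- Casimir element to the other.
  have h2 : ∀ a l, ∑ k, φ l (a * m k) • d k = a * d l := fun a l => by
    apply h.1
    ext x
    simp only [map_sum, LinearMap.sum_apply, map_smul, LinearMap.smul_apply, hd]
    rw [mul_comm, hmul, hd]
    conv_rhs => rw [← hm x]
    simp [Finset.mul_sum, mul_comm]
  have : Algebra.FormallyUnramified B A := by
    refine Algebra.FormallyUnramified.iff_exists_tensorProduct.2
      ⟨∑ k, m k ⊗ₜ d k, fun a => ?_, by simpa using h1⟩
    rw [sub_mul, sub_eq_zero, Finset.mul_sum, Finset.mul_sum]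
    simp only [Algebra.TensorProduct.tmul_mul_tmul, one_mul]
    have h3 : ∀ k, a * m k = ∑ l, φ l (a * m k) • m l := fun k => (hm _).symm
    simp_rw [← h2 a]
    conv_rhs => enter [2, k]; rw [h3 k]
    simp_rw [TensorProduct.tmul_sum, TensorProduct.sum_tmul, TensorProduct.smul_tmul]
    rw [Finset.sum_comm]
  have : Module.FinitePresentation B A := Module.finitePresentation_of_projective B A
  exact .of_formallyUnramified_of_flat

/-- Perfectness of the trace form descends along faithfully flat base change. -/
lemma isEtale_of_isEtale_tensorProduct (T : Type*) [CommRing T] [Algebra B T]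
    [Module.FaithfullyFlat B T] [Module.Finite B A] [Module.Projective B A]
    (h : IsEtale T (T ⊗[B] A)) : IsEtale B A := by
  obtain ⟨r, φ, m, hm⟩ := exists_dual_basis (B := B) (A := A)
  obtain ⟨φ', hφ, hm'⟩ := exists_dual_basis_baseChange (LinearEquiv.refl T (T ⊗[B] A)) φ m hm
  simp only [LinearEquiv.refl_apply] at hφ hm'
  have key : ∀ a b, traceMap T (T ⊗[B] A) (1 ⊗ₜ a) (1 ⊗ₜ b) =
      algebraMap B T (traceMap B A a b) := fun a b => by
    rw [traceMap_apply_eq_sum φ m hm, traceMap_apply_eq_sum φ' _ hm', map_sum]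
    simp [← hφ]
  have : Module.FinitePresentation B A := Module.finitePresentation_of_projective B A
  -- The dual of `A` commutes with base change to `T`, and `E` turns the base change of `Φ` into the
  -- trace map of `T ⊗ A`.
  let E : T ⊗[B] (A →ₗ[B] B) ≃ₗ[T] Module.Dual T (T ⊗[B] A) :=
    (Module.FinitePresentation.isBaseChange_map B A B T).equiv ≪≫ₗ
      LinearEquiv.congrRight (TensorProduct.AlgebraTensorModule.rid B T T)
  have hE : E.toLinearMap ∘ₗ (traceMap B A).baseChange T = traceMap T (T ⊗[B] A) := by
    ext a b
    simp only [TensorProduct.AlgebraTensorModule.curry_apply,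
      TensorProduct.curry_apply, LinearMap.coe_restrictScalars, key]
    simp [E, IsBaseChange.equiv_tmul]
    simp [LinearEquiv.congrRight, Algebra.smul_def]
  rw [IsEtale, ← Module.FaithfullyFlat.lTensor_bijective_iff_bijective B T,
    ← EquivLike.comp_bijective _ E]
  rw [IsEtale, ← hE] at h
  exact h

end TraceForm

/-! ### Local freeness in terms of ranks at primes -/

section LocallyFree

variable {n : ℕ} {B A : Type*} [CommRing B] [CommRing A] [Algebra B A]

/-- Every prime avoids some `b i`, hence comes from the localization at `b i`, where the rank is
`n`. -/
lemma IsLocallyFree.rankAtStalk_eq (h : IsLocallyFree n B A) (p : PrimeSpectrum B) :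
    Module.rankAtStalk A p = n := by
  obtain ⟨_, _⟩ := h.finite_projective
  obtain ⟨m, b, hb, H⟩ := h
  obtain ⟨i, hi⟩ : ∃ i, b i ∉ p.asIdeal := by
    by_contra! hc
    refine p.isPrime.ne_top (top_le_iff.1 (hb ▸ Ideal.span_le.2 ?_))
    rintro _ ⟨i, rfl⟩
    exact hc i
  obtain ⟨q, rfl⟩ : p ∈ Set.range
      (PrimeSpectrum.comap (algebraMap B (Localization.Away (b i)))) := by
    rw [PrimeSpectrum.localization_away_comap_range (Localization.Away (b i)) (b i)]
    exact hi
  obtain ⟨c⟩ := H i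
  have := q.nontrivial
  have := Module.Free.of_basis c
  have := Module.Finite.of_basis c
  rw [← Module.rankAtStalk_baseChange, Module.rankAtStalk_eq_finrank_of_free,
    Module.finrank_eq_card_basis c]
  simp

/-- Constant rank makes `A` free on a basic open neighbourhood of each closed point, so the `a` with
`A` free of rank `n` away from `a` lie in no common maximal ideal. -/
lemma isLocallyFree_of_rankAtStalk_eq [Module.Finite B A] [Module.Projective B A]
    (h : ∀ p : PrimeSpectrum B, Module.rankAtStalk A p = n) : IsLocallyFree n B A := by
  let s : Set B := {a | Nonempty (Module.Basis (Fin n) (Localization.Away a)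
    (Localization.Away a ⊗[B] A))}
  have hs : Ideal.span s = ⊤ := by
    by_contra hc
    obtain ⟨p, hp, hsp⟩ := Ideal.exists_le_maximal _ hc
    obtain ⟨a, ha, hfree⟩ := Module.Free.away_of_finite_of_flat_of_rankAtStalk_constant A p
      fun m _ => by rw [h, h]
    refine ha (hsp (Ideal.subset_span ?_))
    have := Module.Free.of_equiv (IsLocalizedModule.isBaseChange (Submonoid.powers a)
      (Localization.Away a) (LocalizedModule.mkLinearMap (Submonoid.powers a) A)).equiv.symm
    -- Since `a ∉ p`, `a` is not nilpotent; the localization therefore has a prime `q` at which the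
    -- rank of the free module is seen to be `n`.
    have : Nontrivial (Localization.Away a) := by
      rw [← not_subsingleton_iff_nontrivial,
        IsLocalization.subsingleton_iff (M := Submonoid.powers a)]
      rintro ⟨k, hk⟩
      refine ha (hp.isPrime.mem_of_pow_mem k ?_)
      simp only at hk
      exact hk ▸ p.zero_mem
    obtain ⟨q⟩ := (inferInstance : Nonempty (PrimeSpectrum (Localization.Away a)))
    refine ⟨Module.finBasisOfFinrankEq _ _ ?_⟩
    have hq := congrFun (Module.rankAtStalk_eq_finrank_of_free (R := Localization.Away a)
      (M := Localization.Away a ⊗[B] A)) q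
    rw [Module.rankAtStalk_baseChange, h] at hq
    exact hq.symm
  obtain ⟨t, hts, ht⟩ := (Ideal.span_eq_top_iff_finite s).1 hs
  refine ⟨t.card, fun i => (t.equivFin.symm i : B), ?_, fun i => hts (t.equivFin.symm i).2⟩
  rw [← ht]
  congr 1
  ext x
  constructor
  · rintro ⟨i, rfl⟩
    exact (t.equivFin.symm i).2
  · exact fun hx => ⟨t.equivFin ⟨x, hx⟩, by simp⟩

end LocallyFree

/-! ### Splitting étale algebras and faithfully flat descent -/

variable {n : ℕ}

/-- A finite étale algebra of rank `n` becomes isomorphic to `Tⁿ` after a faithfully flat base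
change to some `T`. -/
lemma IsLocallyFree.exists_tensorProduct_equiv_pi_of_faithfullyFlat {B : Type u} {A : Type v}
    [CommRing B] [CommRing A] [Algebra B A] (h : IsLocallyFree n B A) [Algebra.Etale B A]
    (B' : Type (max u v)) [CommRing B'] [Algebra B B'] [Module.FaithfullyFlat B B'] :
    ∃ (T : Type (max u v)) (_ : CommRing T) (_ : Algebra B T),
      Module.FaithfullyFlat B T ∧ Nonempty (T ⊗[B] A ≃ₐ[T] (Fin n → T)) := by
  obtain ⟨_, _⟩ := h.finite_projective
  have hrank : Module.rankAtStalk (R := B') (B' ⊗[B] A) = n := by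
    ext p
    rw [Module.rankAtStalk_baseChange, h.rankAtStalk_eq]
    simp
  obtain ⟨T, _, _, _, _, _, hT⟩ :=
    Algebra.IsFiniteSplit.exists_tensorProduct_of_etale (R := B') (S := B' ⊗[B] A) hrank
  let _ : Algebra B T := ((algebraMap B' T).comp (algebraMap B B')).toAlgebra
  have : IsScalarTower B B' T := .of_algebraMap_eq' rfl
  have hff : Module.FaithfullyFlat B T := Module.FaithfullyFlat.trans B B' T
  obtain ⟨m, ⟨e⟩⟩ := hT.nonempty_algEquiv_fun
  let e' : T ⊗[B] A ≃ₐ[T] (Fin m → T) :=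
    (Algebra.TensorProduct.cancelBaseChange B B' T T A).symm.trans e
  refine ⟨T, inferInstance, inferInstance, hff, ?_⟩
  -- Over the zero ring `m` is not determined, but both algebras are zero; otherwise `m = n` by
  -- comparing ranks at a prime of `T`.
  rcases subsingleton_or_nontrivial T with hs | hn
  · have : Subsingleton (T ⊗[B] A) := e'.toEquiv.subsingleton
    exact ⟨default⟩
  · have hm : m = n := by
      obtain ⟨q⟩ := (inferInstance : Nonempty (PrimeSpectrum T))
      have h1 := congrFun (Module.rankAtStalk_eq_finrank_of_free (R := T) (M := Fin m → T)) q
      rw [← Module.rankAtStalk_eq_of_equiv e'.toLinearEquiv, Module.rankAtStalk_baseChange,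
        h.rankAtStalk_eq] at h1
      simpa using h1.symm
    subst hm
    exact ⟨e'⟩

/-- `B'` is a copy of `B`, needed only to lie in the same universe as `B' ⊗ A`. -/
lemma IsLocallyFree.exists_tensorProduct_equiv_pi {B : Type u} {A : Type v} [CommRing B]
    [CommRing A] [Algebra B A] (h : IsLocallyFree n B A) [Algebra.Etale B A] :
    ∃ (T : Type (max u v)) (_ : CommRing T) (_ : Algebra B T),
      Module.FaithfullyFlat B T ∧ Nonempty (T ⊗[B] A ≃ₐ[T] (Fin n → T)) :=
  have : Module.FaithfullyFlat B (ULift.{v} B) := .of_linearEquiv _ _ ULift.moduleEquiv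
  h.exists_tensorProduct_equiv_pi_of_faithfullyFlat (ULift.{v} B)

/-- An algebra which is isomorphic to `Tᵐ` after a faithfully flat base change to `T` is étale and
locally free of rank `m`. -/
lemma etale_isLocallyFree_isEtale_of_tensorProduct_equiv_pi {B G T : Type*} [CommRing B]
    [CommRing G] [Algebra B G] [CommRing T] [Algebra B T] [Module.FaithfullyFlat B T]
    {ι : Type*} [Fintype ι] (e : T ⊗[B] G ≃ₐ[T] (ι → T)) :
    Algebra.Etale B G ∧ IsLocallyFree (Fintype.card ι) B G ∧ IsEtale B G := by
  have : Algebra.Etale T (T ⊗[B] G) := .of_equiv e.symm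
  have : Module.Finite T (T ⊗[B] G) := Module.Finite.equiv e.symm.toLinearEquiv
  have h1 : Algebra.Etale B G := .of_etale_tensorProduct_of_faithfullyFlat T
  have : Module.Finite B G := .of_finite_tensorProduct_of_faithfullyFlat T
  have : Module.FinitePresentation B G := .of_finite_of_finitePresentation B G
  have : Module.Projective B G := Module.Flat.projective_of_finitePresentation
  refine ⟨h1, isLocallyFree_of_rankAtStalk_eq fun p => ?_,
    isEtale_of_isEtale_tensorProduct T (isEtale_of_algEquiv_pi e)⟩
  -- `Spec T → Spec B` is surjective, so the rank at every prime of `B` can be computed over `T`.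
  obtain ⟨q, rfl⟩ := PrimeSpectrum.comap_surjective_of_faithfullyFlat (A := B) (B := T) p
  have := q.nontrivial
  have h2 := congrFun (Module.rankAtStalk_eq_finrank_of_free (R := T) (M := ι → T)) q
  rw [← Module.rankAtStalk_eq_of_equiv e.toLinearEquiv, Module.rankAtStalk_baseChange] at h2
  simpa using h2

/-- The `S_n`-closure of an étale algebra of rank `n` is étale of rank `n!`. -/
lemma IsLocallyFree.snClosure {B : Type u} {A : Type v} [CommRing B] [CommRing A] [Algebra B A]
    (h : IsLocallyFree n B A) [Algebra.Etale B A] :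
    Algebra.Etale B (SnClosure n B A) ∧ IsLocallyFree n.factorial B (SnClosure n B A) ∧
      IsEtale B (SnClosure n B A) := by
  obtain ⟨_, _⟩ := h.finite_projective
  obtain ⟨T, _, _, _, ⟨e⟩⟩ := h.exists_tensorProduct_equiv_pi
  have := etale_isLocallyFree_isEtale_of_tensorProduct_equiv_pi
    ((tensorEquivSplit e).trans (piEquiv n T))
  rwa [Fintype.card_perm, Fintype.card_fin] at this

lemma IsLocallyFree.of_algEquiv {B A A' : Type*} [CommRing B] [CommRing A] [CommRing A']
    [Algebra B A] [Algebra B A'] (e : A ≃ₐ[B] A') (h : IsLocallyFree n B A) :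
    IsLocallyFree n B A' := by
  obtain ⟨m, b, hb, H⟩ := h
  exact ⟨m, b, hb, fun i => (H i).map fun c =>
    c.map (e.toLinearEquiv.baseChange B (Localization.Away (b i)) A A')⟩

end SnClosure

open CategoryTheory Opposite AlgebraicGeometry AlgebraicGeometry.Scheme

/-! ### The closure of a covering of schemes -/

namespace AlgebraicGeometry

attribute [local instance] appAlgebra

/-- If `ι : Spec R → Z` is an open immersion onto the preimage of an affine open `U` under
`π : Z → Y`, then `Γ(Z, π⁻¹ U)` is isomorphic to `R` over `Γ(Y, U)`. -/
lemma exists_iso_of_opensRange_eq_preimage {Y Z : Scheme.{u}} (π : Z ⟶ Y) {U : Y.Opens}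
    (hU : IsAffineOpen U) {R : CommRingCat.{u}} (α : Γ(Y, U) ⟶ R) (ι : Spec R ⟶ Z)
    [IsOpenImmersion ι] (hι : ι ≫ π = Spec.map α ≫ hU.fromSpec)
    (hr : π ⁻¹ᵁ U = ι.opensRange) : ∃ e : R ≅ Γ(Z, π ⁻¹ᵁ U), α ≫ e.hom = π.app U := by
  have htop : ι ⁻¹ᵁ π ⁻¹ᵁ U = ⊤ := by rw [hr, Scheme.Hom.preimage_opensRange]
  have := ι.isIso_app (π ⁻¹ᵁ U) hr.le
  -- Pullback along `ι` is an isomorphism on these sections, since the image of `ι` is all of `π⁻¹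
  -- U`.
  let β : Γ(Z, π ⁻¹ᵁ U) ⟶ R := ι.app (π ⁻¹ᵁ U) ≫ (Spec R).presheaf.map (eqToHom htop.symm).op ≫
    (Scheme.ΓSpecIso R).hom
  have hβ : π.app U ≫ β = α := by
    have htop' : (⊤ : (Spec R).Opens) ≤ (ι ≫ π) ⁻¹ᵁ U := by
      rw [Scheme.Hom.comp_preimage, htop]
    have h1 : π.app U ≫ ι.app (π ⁻¹ᵁ U) ≫ (Spec R).presheaf.map (eqToHom htop.symm).op =
        (ι ≫ π).appLE U ⊤ htop' := by
      exact (Scheme.Hom.comp_appLE ι π U ⊤ htop').symm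
    -- The morphism `g` is kept variable because the type of `e` depends on it.
    have h2 : ∀ (g : Spec R ⟶ Y) (_ : g = Spec.map α ≫ hU.fromSpec) (e : ⊤ ≤ g ⁻¹ᵁ U),
        g.appLE U ⊤ e = (Scheme.ΓSpecIso Γ(Y, U)).inv ≫ (Spec.map α).appTop := by
      rintro _ rfl e
      have h3 := (Spec.map α).map_appLE (U' := ⊤) (V := ⊤) (U := hU.fromSpec ⁻¹ᵁ U) e
        (eqToHom hU.fromSpec_preimage_self).op
      refine (Scheme.Hom.comp_appLE (Spec.map α) hU.fromSpec U ⊤ e).trans ?_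
      refine (congrArg (· ≫ (Spec.map α).appLE (hU.fromSpec ⁻¹ᵁ U) ⊤ e)
        hU.fromSpec_app_self).trans ?_
      refine (Category.assoc _ _ _).trans (congrArg ((Scheme.ΓSpecIso Γ(Y, U)).inv ≫ ·) ?_)
      exact h3.trans (Spec.map α).appLE_eq_app
    simp only [β]
    rw [← Category.assoc (ι.app _), ← Category.assoc (π.app U), h1, h2 _ hι, Category.assoc,
      Scheme.ΓSpecIso_naturality, Iso.inv_hom_id_assoc]
  refine ⟨(asIso β).symm, ?_⟩
  rw [← hβ]
  simp

namespace IsCovering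

variable {n : ℕ} {X Y : Scheme.{u}} {f : X ⟶ Y}

instance (h : IsCovering n f) :
    (h.snClosureGluingData.functor ⋙ Scheme.forget).IsLocallyDirected :=
  Cover.RelativeGluingData.instIsLocallyDirectedI₀CompFunctorForgetOfIsThin ..

/-- The open cover of `G(X/Y)` by the schemes `Spec G(Γ(X, f⁻¹ U) / Γ(Y, U))`. -/
def snClosureOpenCover (h : IsCovering n f) : h.snClosure.OpenCover :=
  h.snClosureGluingData.cover

/-- The inclusion of `Spec G(Γ(X, f⁻¹ U) / Γ(Y, U))` into `G(X/Y)`. -/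
def snClosureι (h : IsCovering n f) (U : Y.AffineZariskiSite) :
    Spec ((SnClosure.sheaf h).obj (op U)) ⟶ h.snClosure :=
  h.snClosureOpenCover.f U

instance (h : IsCovering n f) (U : Y.AffineZariskiSite) : IsOpenImmersion (h.snClosureι U) :=
  h.snClosureOpenCover.map_prop U

lemma snClosureι_comp_snClosureMap (h : IsCovering n f) (U : Y.AffineZariskiSite) :
    h.snClosureι U ≫ h.snClosureMap =
      Spec.map ((SnClosure.sheafMap h).app (op U)) ≫ U.2.fromSpec :=
  Limits.colimit.ι_desc _ _

lemma snClosureMap_preimage (h : IsCovering n f) (U : Y.AffineZariskiSite) :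
    h.snClosureMap ⁻¹ᵁ U.1 = (h.snClosureι U).opensRange := by
  simpa using! h.snClosureGluingData.toBase_preimage_eq_opensRange_ι U

/-- The sections of `G(X/Y)` over the preimage of an affine open `U` are
`G(Γ(X, f⁻¹ U) / Γ(Y, U))`. -/
lemma nonempty_algEquiv_snClosure (h : IsCovering n f) (U : Y.AffineZariskiSite) :
    Nonempty (SnClosure n Γ(Y, U.1) Γ(X, f ⁻¹ᵁ U.1) ≃ₐ[Γ(Y, U.1)]
      Γ(h.snClosure, h.snClosureMap ⁻¹ᵁ U.1)) := by
  obtain ⟨e, he⟩ := exists_iso_of_opensRange_eq_preimage h.snClosureMap U.2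
    ((SnClosure.sheafMap h).app (op U)) (h.snClosureι U)
    (h.snClosureι_comp_snClosureMap U) (h.snClosureMap_preimage U)
  exact ⟨AlgEquiv.ofRingEquiv (f := e.commRingCatIsoToRingEquiv) fun b => congr($he b)⟩

lemma isAffineHom_snClosureMap (h : IsCovering n f) : IsAffineHom h.snClosureMap where
  isAffine_preimage U hU := by
    let V : Y.AffineZariskiSite := ⟨U, hU⟩
    rw [h.snClosureMap_preimage V]
    exact isAffineOpen_opensRange (h.snClosureι V)

lemma etale_algebra (h : IsCovering n f) [AlgebraicGeometry.Etale f]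
    {U : Y.Opens} (hU : IsAffineOpen U) :
    Algebra.Etale Γ(Y, U) Γ(X, f ⁻¹ᵁ U) := by
  have := h.isAffineHom
  have := f.etale_appLE hU (hU.preimage f) le_rfl
  rw [Scheme.Hom.appLE_eq_app] at this
  exact this

lemma snClosure_isCovering (h : IsCovering n f) [AlgebraicGeometry.Etale f] :
    IsCovering n.factorial h.snClosureMap where
  isAffineHom := h.isAffineHom_snClosureMap
  isLocallyFree U hU := by
    have := h.etale_algebra hU
    obtain ⟨e⟩ := h.nonempty_algEquiv_snClosure ⟨U, hU⟩
    exact (h.isLocallyFree U hU).snClosure.2.1.of_algEquiv e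

lemma etale_snClosureι_comp (h : IsCovering n f) [AlgebraicGeometry.Etale f]
    (U : Y.AffineZariskiSite) : AlgebraicGeometry.Etale (h.snClosureι U ≫ h.snClosureMap) := by
  rw [snClosureι_comp_snClosureMap]
  have := h.etale_algebra U.2
  have : AlgebraicGeometry.Etale (Spec.map ((SnClosure.sheafMap h).app (op U))) :=
    (HasRingHomProperty.Spec_iff (P := @AlgebraicGeometry.Etale)).2
      (RingHom.etale_algebraMap.2 (h.isLocallyFree U.1 U.2).snClosure.1)
  have hU : AlgebraicGeometry.Etale U.2.fromSpec := inferInstance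
  exact @Etale.etale_comp _ _ _ _ _ this hU

/-- Étaleness is local on the source, and on each chart the map is `Spec` of an étale ring map
followed by the open immersion of `U` into `Y`. -/
lemma etale_snClosureMap (h : IsCovering n f) [AlgebraicGeometry.Etale f] :
    AlgebraicGeometry.Etale h.snClosureMap := by
  have : IsZariskiLocalAtSource @AlgebraicGeometry.Etale.{u} :=
    HasRingHomProperty.instIsZariskiLocalAtSource (Q := RingHom.Etale)
  exact (IsZariskiLocalAtSource.iff_of_openCover (P := @AlgebraicGeometry.Etale)
    h.snClosureOpenCover).2 h.etale_snClosureι_comp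

end IsCovering

end AlgebraicGeometry

end

theorem theorem4 :
    -- the split case: `G(Bⁿ/B)` has the `B`-basis `e_σ = ∏ᵢ eᵢ^{(σ(i))}` of orthogonal idempotents
    (∀ (n : ℕ) (B : Type u) [CommRing B],
      ∃ e : Module.Basis (Equiv.Perm (Fin n)) B (SnClosure n B (Fin n → B)),
        (∀ σ, e σ = ∏ i, SnClosure.conj n B (Fin n → B) (σ i) (Pi.single i 1)) ∧
        CompleteOrthogonalIdempotents e ∧
        (∀ g σ, SnClosure.action n B (Fin n → B) g (e σ) = e (g * σ)) ∧
        Nonempty (SnClosure n B (Fin n → B) ≃ₐ[B] (Fin n.factorial → B)) ∧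
        ∃ φ : SnClosure n B (Fin n → B) ≃ₗ[B] MonoidAlgebra B (Equiv.Perm (Fin n)),
          (∀ σ, φ (e σ) = MonoidAlgebra.single σ 1) ∧
          ∀ g x, φ (SnClosure.action n B (Fin n → B) g x) = MonoidAlgebra.single g 1 * φ x) ∧
    -- the étale case
    (∀ (n : ℕ) (B : Type u) [CommRing B] (A : Type v) [CommRing A] [Algebra B A],
      SnClosure.IsLocallyFree n B A → SnClosure.IsEtale B A →
        SnClosure.IsLocallyFree n.factorial B (SnClosure n B A) ∧
          SnClosure.IsEtale B (SnClosure n B A)) ∧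
    -- the étale case for schemes
    (∀ (n : ℕ) (X Y : AlgebraicGeometry.Scheme.{u}) (f : X ⟶ Y)
        (h : AlgebraicGeometry.IsCovering n f), AlgebraicGeometry.Etale f →
        AlgebraicGeometry.IsCovering n.factorial h.snClosureMap ∧
          AlgebraicGeometry.Etale h.snClosureMap) := by
  refine ⟨fun n B _ => SnClosure.exists_basis_pi n B, fun n B _ A _ _ h hE => ?_,
    fun n X Y f h _ => ⟨h.snClosure_isCovering, h.etale_snClosureMap⟩⟩
  obtain ⟨_, _⟩ := h.finite_projective
  have := hE.etale
  exact h.snClosure.2
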